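/- Let $0<k<1$, $l(t)=1+kt$ and $Q^k=\{(x,t)\in\mathbb R^2: 0<x<l(t),\ t>0\}$. For an open set $\Omega\subset\mathbb R^N$, let $H^1_{loc}(\Omega)$ be the set of functions $u$ on $\Omega$ with $\psi u\in H^1(\Omega)$ for all $\psi\in C_c^\infty(\mathbb R^N)$. For $a\in\mathbb R$ and $(u^0,u^1)\in H^1(0,1)\times L^2(0,1)$ consider $$\begin{cases}u_{tt}-u_{xx}=0&\text{in }Q^k,\\ u_x(0,t)=0,\quad u_x(l(t),t)+a\,u_t(l(t),t)=0&\text{for }t>0,\\ u(x,0)=u^0(x),\quad u_t(x,0)=u^1(x)&\text{for }x\in(0,1).\end{cases}\qquad(\ast)$$ A weak solution of $(\ast)$ is a function $u\in H^1_{loc}(Q^k)$ whose trace on $(0,1)\times\{0\}$ is $u^0$ and for which there are $p,q\in L^2_{loc}([0,\infty))$ (the boundary values of $u_t$ and $u_x$ on the moving boundary) such that the trace $t\mapsto u(l(t),t)$ is in $H^1_{loc}((0,\infty))$ with derivative $kq+p$, $\;q+ap=0$ a.e. on $(0,\infty)$, and for every $\varphi\in C_c^\infty(\mathbb R^2)$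 $$\int_{Q^k}(u_t\varphi_t-u_x\varphi_x)\,dx\,dt+\int_0^\infty (q+kp)(t)\,\varphi(l(t),t)\,dt+\int_0^1u^1(x)\varphi(x,0)\,dx=0 .$$ Then the following hold. (1) If $a\neq-1$, then for all $(u^0,u^1)\in H^1(0,1)\times L^2(0,1)$ the system $(\ast)$ has a weak solution $u\in H^1_{loc}(Q^k)$. If $a=-1$, then $(\ast)$ has a weak solution if and only if $u^0$ is a.e. equal to a constant and $u^1=0$ a.e. (2) For every $a\in\mathbb R$ and all data, $(\ast)$ has at most one weak solution, up to equality almost everywhere in $Q^k$. (3) For every $a\in\mathbb R$, each weak solution $u$ has the form $$u(x,t)=f(t+x)+f(t-x)\qquad\text{for almost every }(x,t)\in Q^k$$ with some $f\in H^1_{loc}(\mathbb R)$ such that, for almost every $x\in(0,1)$, $$f(x)=\tfrac12\Big(u^0(x)+\int_0^xu^1(y)\,dy\Big),\qquad f(-x)=\tfrac12\Big(u^0(x)-\int_0^xu^1(y)\,dy\Big),$$ and, with $F(s)=\dfrac{(1+k)s+2}{1-k}$ (that is, $F(t-l(t))=t+l(t)$), $$(1+a)\,f'(F(s))=(1-a)\,f'(s)\qquad\text{for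 almost every }s>-1 .$$ -/

import Mathlib

open MeasureTheory Set

namespace MovingWave

noncomputable section

/-- Test functions: smooth real functions with compact support in the whole space. -/
def IsTestFunction {E : Type*} [NormedAddCommGroup E] [NormedSpace ℝ E] (φ : E → ℝ) : Prop :=
  ContDiff ℝ ((⊤ : ℕ∞) : WithTop ℕ∞) φ ∧ HasCompactSupport φ

/-- `g` is the derivative of `u` in the direction `v`, in the sense of distributions on the
open set `Ω`. It is only used together with local square integrability of `u` and `g`. -/
def HasWeakDeriv {E : Type*} [NormedAddCommGroup E] [NormedSpace ℝ E] [MeasureSpace E]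
    (Ω : Set E) (v : E) (u g : E → ℝ) : Prop :=
  ∀ φ : E → ℝ, IsTestFunction φ → tsupport φ ⊆ Ω →
    ∫ z in Ω, u z * fderiv ℝ φ z v = - ∫ z in Ω, g z * φ z

/-- Square integrable on every bounded part of `Ω`, up to the boundary of `Ω`:
`u ∈ L²(Ω ∩ K)` for each compact set `K` of the whole space. -/
def MemL2loc {E : Type*} [NormedAddCommGroup E] [NormedSpace ℝ E] [MeasureSpace E]
    (Ω : Set E) (u : E → ℝ) : Prop :=
  ∀ K : Set E, IsCompact K → MemLp u 2 (volume.restrict (Ω ∩ K))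

/-- `u ∈ H¹(I)` for an open set `I` of the real line. -/
def MemH1 (I : Set ℝ) (u : ℝ → ℝ) : Prop :=
  MemLp u 2 (volume.restrict I) ∧
    ∃ g : ℝ → ℝ, MemLp g 2 (volume.restrict I) ∧ HasWeakDeriv I 1 u g

/-- `f ∈ H¹_loc(I)`, with weak derivative `f'`, for an open set `I` of the real line.
Equivalently, `ψ f ∈ H¹(I)` for every `ψ ∈ C_c^∞(ℝ)`. -/
def IsH1loc (I : Set ℝ) (f f' : ℝ → ℝ) : Prop :=
  MemL2loc I f ∧ MemL2loc I f' ∧ HasWeakDeriv I 1 f f'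

/-- `u ∈ H¹_loc(Ω)`, with weak partial derivatives `ux`, `ut`, for an open set `Ω` of the plane
of the points `(x, t)`. Equivalently, `ψ u ∈ H¹(Ω)` for every `ψ ∈ C_c^∞(ℝ²)`. -/
def IsH1locPlane (Ω : Set (ℝ × ℝ)) (u ux ut : ℝ × ℝ → ℝ) : Prop :=
  MemL2loc Ω u ∧ MemL2loc Ω ux ∧ MemL2loc Ω ut ∧
    HasWeakDeriv Ω (1, 0) u ux ∧ HasWeakDeriv Ω (0, 1) u ut

/-- The non-cylindrical domain `{(x, t) : 0 < x < 1 + k t, t > 0}`. -/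
def Q (k : ℝ) : Set (ℝ × ℝ) := {z | 0 < z.1 ∧ z.1 < 1 + k * z.2 ∧ 0 < z.2}

/-- The trace of `u` on the bottom `(0,1) × {0}` is `w`, expressed by Green's formula
(`ut` is the weak time derivative of `u`). -/
def HasInitialTrace (k : ℝ) (u ut : ℝ × ℝ → ℝ) (w : ℝ → ℝ) : Prop :=
  ∀ φ : ℝ × ℝ → ℝ, IsTestFunction φ → tsupport φ ⊆ {z | 0 < z.1 ∧ z.1 < 1} →
    ∫ z in Q k, (ut z * φ z + u z * fderiv ℝ φ z (0, 1)) = - ∫ x in Ioo (0 : ℝ) 1, w x * φ (x, 0)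

/-- The trace of `u` on the moving boundary, `t ↦ u (1 + k t, t)`, is `w`, expressed by Green's
formula (`ux` is the weak space derivative of `u`). -/
def HasMovingTrace (k : ℝ) (u ux : ℝ × ℝ → ℝ) (w : ℝ → ℝ) : Prop :=
  ∀ φ : ℝ × ℝ → ℝ, IsTestFunction φ → tsupport φ ⊆ {z | 0 < z.1 ∧ 0 < z.2} →
    ∫ z in Q k, (ux z * φ z + u z * fderiv ℝ φ z (1, 0))
      = ∫ t in Ioi (0 : ℝ), w t * φ (1 + k * t, t)

/-- Weak solutions `u ∈ H¹_loc(Q k)` of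
`u_tt - u_xx = 0` in `Q k`, `u_x (0, t) = 0`, `u_x (l t, t) + a u_t (l t, t) = 0`,
`u (x, 0) = u0`, `u_t (x, 0) = u1`, where `l t = 1 + k t`.

The functions `q` and `p` are the boundary values of `u_x` and `u_t` on the moving boundary.
Since `k ^ 2 ≠ 1`, they are determined by `u` through
* the flux `q + k p`, which enters Green's formula for the wave equation (last clause), and
* the derivative `k q + p` of `t ↦ u (l t, t)` (the trace `w`).

The last clause is the wave equation multiplied by an arbitrary test function and integrated by
parts over `Q k`; it contains the equation, the Neumann condition at `x = 0` and the initial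
velocity. -/
def IsWeakSolution (k a : ℝ) (u0 u1 : ℝ → ℝ) (u : ℝ × ℝ → ℝ) : Prop :=
  ∃ (ux ut : ℝ × ℝ → ℝ) (w p q : ℝ → ℝ),
    IsH1locPlane (Q k) u ux ut ∧
    MemL2loc (Ioi 0) p ∧ MemL2loc (Ioi 0) q ∧
    HasInitialTrace k u ut u0 ∧
    HasMovingTrace k u ux w ∧
    IsH1loc (Ioi 0) w (fun t => k * q t + p t) ∧
    (∀ᵐ t ∂(volume.restrict (Ioi (0 : ℝ))), q t + a * p t = 0) ∧
    ∀ φ : ℝ × ℝ → ℝ, IsTestFunction φ →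
      (∫ z in Q k, (ut z * fderiv ℝ φ z (0, 1) - ux z * fderiv ℝ φ z (1, 0)))
        + (∫ t in Ioi (0 : ℝ), (q t + k * p t) * φ (1 + k * t, t))
        + (∫ x in Ioo (0 : ℝ) 1, u1 x * φ (x, 0)) = 0

/-- The map `F = (id + l) ∘ (id - l)⁻¹` with `l t = 1 + k t`, in closed form. -/
def F (k s : ℝ) : ℝ := ((1 + k) * s + 2) / (1 - k)

/-- `F` sends `t - l t` to `t + l t`, as it should. -/
theorem F_apply (k t : ℝ) (hk : k < 1) : F k (t - (1 + k * t)) = t + (1 + k * t) := by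
  have h : (1 - k) ≠ 0 := by linarith
  unfold F
  field_simp
  ring

end

end MovingWave

namespace MovingWave

noncomputable section

open Filter Topology ContinuousLinearMap
open scoped Convolution ContDiff

/-! ### Test functions and their derivatives -/

section TestFunctions

variable {E : Type*} [NormedAddCommGroup E] [NormedSpace ℝ E]

/-! The proof is d'Alembert's method carried out for weak solutions. Testing the weak derivatives of
`u` against `φ_t` and `φ_x` gives `∂_x u_t = ∂_t u_x` weakly; with the wave equation, `u_t + u_x`
and `u_t - u_x` have zero weak derivative along the lines `t + x = ξ` and `t - x = ξ`. Mollification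
and Fubini turn this into genuine constancy on almost every characteristic
(`exists_conull_eq_of_weakDeriv_eq_zero`, `IsSlicing.exists_eq_comp_char`), so `u_t = α(t + x) + β(t
- x)` and `u_x = α(t + x) - β(t - x)`.

Green's formula then reads off the boundary data. Test functions concentrated at `x = 0` give `α =
β` on `(0, ∞)`, which is the Neumann condition, and test functions concentrated at `t = 0` give
`u1(x) = α(x) + β(-x)`. Hence there is a single profile `h` in `L²_loc(ℝ)`, and `u` is the wave of a
primitive `f` of `h` (`IsWeakSolution.exists_profile`). At the moving boundary, the flux `q + kp`
and the tangential derivative `kq + p` determine `p` and `q` because `k² ≠ 1`, and `q + ap = 0`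
becomes `(1 + a) h(F s) = (1 - a) h(s)`. Conversely, a profile satisfying this relation and matching
the data yields a weak solution (`isWeakSolution_wave`).

Everything is thus reduced to a functional equation. The data fix `h` on `(-1, 1)`; `F` maps `-1` to
`1` and is an affine expansion about `-1/k < -1`, so the images of `(-1, 1)` under its iterates
cover `(-1, ∞)` up to their endpoints. If `a ≠ -1`, the equation propagates `h` uniquely from `(-1,
1)` (`exists_profile_extension`, `ae_eq_zero_of_functional_eq`). If `a = -1`, it says `0 = 2h`,
which leaves only constant `u0` and zero `u1`. -/

theorem IsTestFunction.continuous {φ : E → ℝ} (h : IsTestFunction φ) : Continuous φ :=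
  h.1.continuous

theorem IsTestFunction.differentiable {φ : E → ℝ} (h : IsTestFunction φ) : Differentiable ℝ φ :=
  h.1.differentiable (by simp)

theorem IsTestFunction.fderiv_apply {φ : E → ℝ} (h : IsTestFunction φ) (v : E) :
    IsTestFunction (fun z => fderiv ℝ φ z v) := by
  refine ⟨?_, ?_⟩
  · exact (h.1.fderiv_right (m := ((⊤ : ℕ∞) : WithTop ℕ∞)) (by simp)).clm_apply contDiff_const
  · exact h.2.fderiv_apply ℝ v

theorem IsTestFunction.fderiv_comm {φ : E → ℝ} (h : IsTestFunction φ) (v w z : E) :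
    fderiv ℝ (fun y => fderiv ℝ φ y v) z w = fderiv ℝ (fun y => fderiv ℝ φ y w) z v := by
  have h2 : (2 : WithTop ℕ∞) ≤ ((⊤ : ℕ∞) : WithTop ℕ∞) := WithTop.coe_le_coe.2 le_top
  have hd : DifferentiableAt ℝ (fderiv ℝ φ) z :=
    ((h.1.fderiv_right (m := 1) (by rwa [one_add_one_eq_two])).differentiable one_ne_zero).differentiableAt
  have hs : IsSymmSndFDerivAt ℝ φ z := h.1.contDiffAt.isSymmSndFDerivAt (by simpa using h2)
  have e (a b : E) : fderiv ℝ (fun y => fderiv ℝ φ y a) z b = fderiv ℝ (fderiv ℝ φ) z b a := by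
    rw [fderiv_clm_apply hd (differentiableAt_const a)]
    simp
  rw [e, e]
  exact hs.eq w v

end TestFunctions

/-! ### Vanishing weak derivatives via mollification -/

section Mollification

variable {E : Type*} [NormedAddCommGroup E] [NormedSpace ℝ E] [FiniteDimensional ℝ E]
  [MeasureSpace E] [BorelSpace E] [(volume : Measure E).IsAddHaarMeasure]

/-- At a point `x` of the segment, the directional derivative of the mollification is, up to sign,
the weak derivative tested against `y ↦ r (x - y)`. That function is supported within `ρ.rOut < δ`
of the segment, hence in `Ω`, so the derivative vanishes along the whole segment. -/
theorem convolution_eq_of_weakDeriv_eq_zero {U : E → ℝ} (hU : LocallyIntegrable U)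
    {Ω : Set E} {z z' : E} {δ : ℝ} (hδ : Metric.cthickening δ (segment ℝ z z') ⊆ Ω)
    (hw : ∀ φ : E → ℝ, IsTestFunction φ → tsupport φ ⊆ Ω →
      ∫ y, U y * fderiv ℝ φ y (z' - z) = 0)
    (ρ : ContDiffBump (0 : E)) (hρ : ρ.rOut < δ) :
    (ρ.normed volume ⋆[lsmul ℝ ℝ, volume] U) z = (ρ.normed volume ⋆[lsmul ℝ ℝ, volume] U) z' := by
  set r := ρ.normed (volume : Measure E) with hr
  have hrs : HasCompactSupport r := ρ.hasCompactSupport_normed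
  have hrc : ContDiff ℝ ∞ r := ρ.contDiff_normed
  have hrc1 : ContDiff ℝ 1 r := ρ.contDiff_normed
  set c : E → ℝ := (r ⋆[lsmul ℝ ℝ, volume] U) with hc
  have hcU : c = (U ⋆[(lsmul ℝ ℝ).flip, volume] r) := by rw [hc, ← convolution_flip]
  have key : ∀ x ∈ segment ℝ z z', HasFDerivAt c (fderiv ℝ c x) x ∧ fderiv ℝ c x (z' - z) = 0 := by
    intro x hx
    have h1 := hrs.hasFDerivAt_convolution_right (μ := volume) ((lsmul ℝ ℝ : ℝ →L[ℝ] ℝ →L[ℝ] ℝ).flip)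
      hU hrc1 x
    rw [← hcU] at h1
    refine ⟨h1.differentiableAt.hasFDerivAt, ?_⟩
    rw [h1.fderiv, convolution_precompR_apply _ hU (hrs.fderiv ℝ) (hrc1.continuous_fderiv (by simp))]
    have hdiff : Differentiable ℝ r := hrc1.differentiable (by simp)
    have hφ : IsTestFunction (fun y => r (x - y)) := by
      refine ⟨hrc.comp (contDiff_const.sub contDiff_id), ?_⟩
      exact hrs.comp_homeomorph (Homeomorph.subLeft x)
    have hsupp : tsupport (fun y => r (x - y)) ⊆ Ω := by
      refine subset_trans ?_ hδ
      refine closure_minimal ?_ Metric.isClosed_cthickening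
      intro y hy
      have : x - y ∈ Function.support r := hy
      rw [hr, ρ.support_normed_eq, Metric.mem_ball, dist_zero_right] at this
      refine Metric.mem_cthickening_of_dist_le y x δ _ hx ?_
      rw [dist_comm, dist_eq_norm]; linarith
    have h2 := hw _ hφ hsupp
    have h3 : ∀ y, fderiv ℝ (fun y => r (x - y)) y (z' - z) = - fderiv ℝ r (x - y) (z' - z) := by
      intro y
      have : HasFDerivAt (fun y => r (x - y)) ((fderiv ℝ r (x - y)).comp (-ContinuousLinearMap.id ℝ E)) y :=
        (hdiff (x - y)).hasFDerivAt.comp y ((hasFDerivAt_id y).const_sub x)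
      rw [this.fderiv]; simp
    simp only [h3, mul_neg, integral_neg, neg_eq_zero] at h2
    rw [← h2, convolution_def]
    refine integral_congr_ae (Eventually.of_forall fun y => ?_)
    simp [mul_comm]
  let ℓ : ℝ → E := fun s => z + s • (z' - z)
  have hℓ : ∀ s, HasDerivAt ℓ (z' - z) s := fun s => by
    simpa [ℓ] using ((hasDerivAt_id s).smul_const (z' - z)).const_add z
  have hmem : ∀ s ∈ Icc (0 : ℝ) 1, ℓ s ∈ segment ℝ z z' := fun s hs => by
    rw [segment_eq_image']; exact ⟨s, hs, rfl⟩
  have hd : ∀ s ∈ Icc (0 : ℝ) 1, HasDerivAt (c ∘ ℓ) 0 s := fun s hs => by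
    have := (key _ (hmem s hs)).1.comp_hasDerivAt s (hℓ s)
    rwa [(key _ (hmem s hs)).2] at this
  have := constant_of_has_deriv_right_zero (f := c ∘ ℓ) (a := 0) (b := 1)
    (fun s hs => (hd s hs).continuousAt.continuousWithinAt)
    (fun s hs => (hd s (Ico_subset_Icc_self hs)).hasDerivWithinAt) 1 (by simp)
  simp [ℓ] at this
  exact this.symm

/-- A locally integrable function takes the same value at almost all pairs of points joined by a
segment in `Ω` in whose direction its weak derivative vanishes. -/
theorem exists_conull_eq_of_weakDeriv_eq_zero {U : E → ℝ} (hU : LocallyIntegrable U)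
    {Ω : Set E} (hΩ : IsOpen Ω) :
    ∃ G : Set E, (∀ᵐ z, z ∈ G) ∧ ∀ z ∈ G, ∀ z' ∈ G, segment ℝ z z' ⊆ Ω →
      (∀ φ : E → ℝ, IsTestFunction φ → tsupport φ ⊆ Ω →
        ∫ y, U y * fderiv ℝ φ y (z' - z) = 0) → U z = U z' := by
  let ρ : ℕ → ContDiffBump (0 : E) := fun n =>
    ⟨1 / (n + 1 : ℝ), 2 * (1 / (n + 1 : ℝ)), by positivity, by
      have : (0 : ℝ) < 1 / (n + 1 : ℝ) := by positivity
      linarith⟩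
  have h0 : Tendsto (fun n => (ρ n).rOut) atTop (𝓝 0) := by
    simpa [ρ] using (tendsto_one_div_add_atTop_nhds_zero_nat (𝕜 := ℝ)).const_mul 2
  -- `G` is the set where the mollifications converge to `U`. It does not depend on a direction, so
  -- one null set serves all pairs of points.
  refine ⟨_, ContDiffBump.ae_convolution_tendsto_right_of_locallyIntegrable (φ := ρ) (K := 2)
    (l := atTop) h0 (Eventually.of_forall fun n => le_rfl) hU, ?_⟩
  intro z hz z' hz' hseg hw
  have hcpt : IsCompact (segment ℝ z z') := by
    rw [segment_eq_image']
    exact isCompact_Icc.image (by fun_prop)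
  obtain ⟨δ, hδ, hsub⟩ := hcpt.exists_cthickening_subset_open hΩ hseg
  refine tendsto_nhds_unique (Tendsto.congr' ?_ hz) hz'
  filter_upwards [h0.eventually_lt_const hδ] with n hn
  exact convolution_eq_of_weakDeriv_eq_zero hU hsub hw (ρ n) hn

/-- By convexity every good point of `Ω` is joined inside `Ω` to one fixed good point, whose value
is the constant. -/
theorem ae_eq_const_of_weakDeriv_eq_zero {U : E → ℝ} {Ω : Set E} (hΩ : IsOpen Ω)
    (hconv : Convex ℝ Ω) (hU : LocallyIntegrable (Ω.indicator U))
    (hw : ∀ v : E, ∀ φ : E → ℝ, IsTestFunction φ → tsupport φ ⊆ Ω →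
        ∫ y in Ω, U y * fderiv ℝ φ y v = 0) :
    ∃ c : ℝ, ∀ᵐ z ∂(volume.restrict Ω), U z = c := by
  obtain ⟨G, hG, h⟩ := exists_conull_eq_of_weakDeriv_eq_zero hU hΩ
  have hw' (v : E) (φ : E → ℝ) (hφ : IsTestFunction φ) (hs : tsupport φ ⊆ Ω) :
      ∫ y, Ω.indicator U y * fderiv ℝ φ y v = 0 := by
    rw [← hw v φ hφ hs, ← integral_indicator hΩ.measurableSet]
    simp only [indicator_mul_left]
  by_cases hne : ∃ z₀ ∈ Ω, z₀ ∈ G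
  · obtain ⟨z₀, hz₀, hg₀⟩ := hne
    refine ⟨U z₀, ?_⟩
    rw [ae_restrict_iff' hΩ.measurableSet]
    filter_upwards [hG] with z hz hzΩ
    have := h z hz z₀ hg₀ (hconv.segment_subset hzΩ hz₀) (hw' _)
    simpa [hzΩ, hz₀] using this
  · refine ⟨0, ?_⟩
    rw [ae_restrict_iff' hΩ.measurableSet]
    filter_upwards [hG] with z hz hzΩ
    exact absurd ⟨z, hzΩ, hz⟩ hne

end Mollification

/-! ### Local square integrability up to the boundary -/

section SquareIntegrable

variable {E : Type*} [NormedAddCommGroup E] [NormedSpace ℝ E] [MeasureSpace E]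
  {Ω : Set E} {u v : E → ℝ}

theorem memL2loc_univ : MemL2loc univ u ↔ ∀ K, IsCompact K → MemLp u 2 (volume.restrict K) := by
  simp [MemL2loc]

theorem memL2loc_iff_indicator (hΩ : MeasurableSet Ω) :
    MemL2loc Ω u ↔ MemL2loc univ (Ω.indicator u) := by
  rw [memL2loc_univ]
  refine forall₂_congr fun K hK => ?_
  rw [memLp_indicator_iff_restrict hΩ, Measure.restrict_restrict hΩ]

theorem MemL2loc.add (hu : MemL2loc Ω u) (hv : MemL2loc Ω v) :
    MemL2loc Ω (fun z => u z + v z) := fun K hK => (hu K hK).add (hv K hK)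

theorem MemL2loc.sub (hu : MemL2loc Ω u) (hv : MemL2loc Ω v) :
    MemL2loc Ω (fun z => u z - v z) := fun K hK => (hu K hK).sub (hv K hK)

theorem MemL2loc.const_mul (hu : MemL2loc Ω u) (c : ℝ) :
    MemL2loc Ω (fun z => c * u z) := fun K hK => (hu K hK).const_mul c

theorem MemL2loc.mono {Ω' : Set E} (hu : MemL2loc Ω u) (h : Ω' ⊆ Ω) : MemL2loc Ω' u :=
  fun K hK => (hu K hK).mono_measure (Measure.restrict_mono (inter_subset_inter_left K h) le_rfl)

variable [IsFiniteMeasureOnCompacts (volume : Measure E)]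

theorem MemL2loc.locallyIntegrable [WeaklyLocallyCompactSpace E] (hu : MemL2loc univ u) :
    LocallyIntegrable u := by
  intro x
  obtain ⟨K, hK, hx⟩ := exists_compact_mem_nhds x
  have : IsFiniteMeasure (volume.restrict K) := ⟨by simpa using hK.measure_lt_top⟩
  exact ⟨K, hx, ((memL2loc_univ.1 hu) K hK).integrable (by norm_num)⟩

theorem MemL2loc.locallyIntegrable_indicator [WeaklyLocallyCompactSpace E]
    (hΩ : MeasurableSet Ω) (hu : MemL2loc Ω u) :
    LocallyIntegrable (Ω.indicator u) :=
  ((memL2loc_iff_indicator hΩ).1 hu).locallyIntegrable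

variable [BorelSpace E]

theorem memL2loc_of_continuous (hu : Continuous u) : MemL2loc Ω u := by
  suffices h : MemL2loc univ u from h.mono (subset_univ _)
  rw [memL2loc_univ]
  intro K hK
  have : IsFiniteMeasure (volume.restrict K) := ⟨by simpa using hK.measure_lt_top⟩
  obtain ⟨C, hC⟩ := hK.exists_bound_of_continuousOn hu.continuousOn
  exact MemLp.of_bound (hu.continuousOn.aestronglyMeasurable_of_isCompact hK hK.measurableSet) C
    ((ae_restrict_iff' hK.measurableSet).2 (Eventually.of_forall hC))

variable [WeaklyLocallyCompactSpace E]

theorem MemL2loc.integrableOn_mul (hΩ : MeasurableSet Ω) (hu : MemL2loc Ω u) {φ : E → ℝ}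
    (hφ : Continuous φ) (hs : HasCompactSupport φ) : IntegrableOn (fun z => u z * φ z) Ω := by
  rw [← integrable_indicator_iff hΩ]
  have := (hu.locallyIntegrable_indicator hΩ).integrable_smul_left_of_hasCompactSupport hφ hs
  refine this.congr (Eventually.of_forall fun z => ?_)
  by_cases hz : z ∈ Ω <;> simp [hz, mul_comm]

theorem MemL2loc.integrableOn_mul_testFunction (hΩ : MeasurableSet Ω) (hu : MemL2loc Ω u)
    {φ : E → ℝ} (hφ : IsTestFunction φ) : IntegrableOn (fun z => u z * φ z) Ω :=
  hu.integrableOn_mul hΩ hφ.continuous hφ.2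

theorem MemL2loc.integrableOn_mul_fderiv (hΩ : MeasurableSet Ω) (hu : MemL2loc Ω u)
    {φ : E → ℝ} (hφ : IsTestFunction φ) (w : E) :
    IntegrableOn (fun z => u z * fderiv ℝ φ z w) Ω :=
  hu.integrableOn_mul_testFunction hΩ (hφ.fderiv_apply w)

end SquareIntegrable

/-! ### Primitives of square integrable functions and `H¹_loc` on the line -/

section Primitive

theorem MemL2loc.intervalIntegrable {h : ℝ → ℝ} (hh : MemL2loc univ h) (a b : ℝ) :
    IntervalIntegrable h volume a b :=
  (hh.locallyIntegrable.integrableOn_isCompact isCompact_uIcc).intervalIntegrable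

theorem map_affine_volume (ξ : ℝ) {m : ℝ} (hm : m ≠ 0) :
    Measure.map (fun x => ξ + m * x) volume = ENNReal.ofReal |m⁻¹| • (volume : Measure ℝ) := by
  have : (fun x => ξ + m * x) = (fun x => ξ + x) ∘ (fun x => m * x) := rfl
  rw [this, ← Measure.map_map (by fun_prop) (by fun_prop), Real.map_volume_mul_left hm,
    Measure.map_smul, map_add_left_eq_self]

theorem quasiMeasurePreserving_affine (ξ : ℝ) {m : ℝ} (hm : m ≠ 0) :
    Measure.QuasiMeasurePreserving (fun x : ℝ => ξ + m * x) := by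
  refine ⟨by fun_prop, ?_⟩
  rw [map_affine_volume ξ hm]
  exact Measure.smul_absolutelyContinuous

theorem MemL2loc.comp_affine {h : ℝ → ℝ} (hh : MemL2loc univ h) (ξ : ℝ) {m : ℝ} (hm : m ≠ 0) :
    MemL2loc univ (fun x => h (ξ + m * x)) := by
  rw [memL2loc_univ] at hh ⊢
  intro K hK
  have hcont : Continuous fun x : ℝ => ξ + m * x := by fun_prop
  set K' := (fun x => ξ + m * x) '' K with hK'
  have hc : IsCompact K' := hK.image hcont
  have hsub : K ⊆ (fun x => ξ + m * x) ⁻¹' K' := subset_preimage_image _ K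
  refine MemLp.mono_measure (Measure.restrict_mono hsub le_rfl) ?_
  have hmap : Measure.map (fun x => ξ + m * x)
      (volume.restrict ((fun x => ξ + m * x) ⁻¹' K')) =
      ENNReal.ofReal |m⁻¹| • volume.restrict K' := by
    rw [← Measure.restrict_map hcont.measurable hc.measurableSet, map_affine_volume ξ hm,
      Measure.restrict_smul]
  have h2 := (hh K' hc).smul_measure (c := ENNReal.ofReal |m⁻¹|) (by simp)
  rw [← hmap] at h2
  exact (memLp_map_measure_iff h2.1 hcont.aemeasurable).1 h2

/-- The primitive of `h` with value `c` at the origin. -/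
def prim (c : ℝ) (h : ℝ → ℝ) (s : ℝ) : ℝ := c + ∫ y in (0 : ℝ)..s, h y

theorem continuous_prim (c : ℝ) {h : ℝ → ℝ} (hh : MemL2loc univ h) : Continuous (prim c h) :=
  continuous_const.add (intervalIntegral.continuous_primitive hh.intervalIntegrable 0)

theorem prim_sub_prim (c : ℝ) {h : ℝ → ℝ} (hh : MemL2loc univ h) (a b : ℝ) :
    prim c h b - prim c h a = ∫ y in a..b, h y := by
  rw [prim, prim, add_sub_add_left_eq_sub]
  exact intervalIntegral.integral_interval_sub_left (hh.intervalIntegrable _ _)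
    (hh.intervalIntegrable _ _)

/-- Restricting a profile of `t ± x` to a line of the plane produces such a composition, so
one-dimensional integration by parts applies on every line. The slope `m = 0` is allowed: it occurs
on characteristics. -/
theorem prim_comp_affine (c : ℝ) {h : ℝ → ℝ} (hh : MemL2loc univ h) (ξ m x : ℝ) :
    prim c h (ξ + m * x) = prim (prim c h ξ) (fun y => m * h (ξ + m * y)) x := by
  have h1 := prim_sub_prim c hh ξ (ξ + m * x)
  have h2 := intervalIntegral.mul_integral_comp_add_mul (a := 0) (b := x) (f := h) m ξ
  rw [mul_zero, add_zero, ← h1] at h2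
  rw [prim.eq_def (prim c h ξ), intervalIntegral.integral_const_mul, h2]
  ring

theorem MemL2loc.const_mul_comp_affine {h : ℝ → ℝ} (hh : MemL2loc univ h) (ξ m : ℝ) :
    MemL2loc univ (fun x => m * h (ξ + m * x)) := by
  by_cases hm : m = 0
  · simpa [hm] using memL2loc_of_continuous (Ω := univ) (u := fun _ : ℝ => (0 : ℝ)) continuous_const
  · exact (hh.comp_affine ξ hm).const_mul m

/-- Integration by parts for absolutely continuous functions; the derivative of the primitive is `h`
almost everywhere by Lebesgue differentiation. -/
theorem integral_prim_mul_deriv (c : ℝ) {h : ℝ → ℝ} (hh : MemL2loc univ h) {ψ ψ' : ℝ → ℝ}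
    (hψ : ∀ x, HasDerivAt ψ (ψ' x) x) (hψ' : Continuous ψ') (a b : ℝ) :
    ∫ x in a..b, (h x * ψ x + prim c h x * ψ' x) = prim c h b * ψ b - prim c h a * ψ a := by
  have hd : deriv ψ = ψ' := funext fun x => (hψ x).deriv
  have hψc : ContDiff ℝ 1 ψ := contDiff_one_iff_deriv.2
    ⟨fun x => (hψ x).differentiableAt, hd ▸ hψ'⟩
  have e : prim c h = fun x => prim c h a + ∫ y in a..x, h y := by
    funext x; rw [← prim_sub_prim c hh]; ring
  have hac : AbsolutelyContinuousOnInterval (prim c h) a b := by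
    rw [e]
    have h1 := (hh.intervalIntegrable a b).absolutelyContinuousOnInterval_intervalIntegral
      (c := a) left_mem_uIcc
    have h2 : AbsolutelyContinuousOnInterval (fun _ : ℝ => prim c h a) a b :=
      (contDiff_const.contDiffOn (n := 1)).absolutelyContinuousOnInterval
    exact h2.add h1
  rw [← hac.integral_deriv_mul_eq_sub (hψc.contDiffOn.absolutelyContinuousOnInterval)]
  refine intervalIntegral.integral_congr_ae ?_
  filter_upwards [(hh.intervalIntegrable a b).ae_hasDerivAt_integral] with x hx hxm
  have := (hx (uIoc_subset_uIcc hxm) a left_mem_uIcc).const_add (prim c h a)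
  rw [hd, e, this.deriv]

theorem integral_prim_comp_affine_mul_deriv (c : ℝ) {h : ℝ → ℝ} (hh : MemL2loc univ h)
    {ψ ψ' : ℝ → ℝ} (hψ : ∀ x, HasDerivAt ψ (ψ' x) x) (hψ' : Continuous ψ') (ξ m a b : ℝ) :
    ∫ x in a..b, (m * h (ξ + m * x) * ψ x + prim c h (ξ + m * x) * ψ' x) =
      prim c h (ξ + m * b) * ψ b - prim c h (ξ + m * a) * ψ a := by
  simp only [prim_comp_affine c hh]
  exact integral_prim_mul_deriv _ (hh.const_mul_comp_affine ξ m) hψ hψ' a b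

theorem setIntegral_eq_integral_of_tsupport_subset {E : Type*} [TopologicalSpace E]
    [MeasureSpace E] {I : Set E} {f φ : E → ℝ} (hs : tsupport φ ⊆ I)
    (hf : ∀ x, φ x = 0 → f x = 0) : ∫ x in I, f x = ∫ x, f x :=
  setIntegral_eq_integral_of_forall_compl_eq_zero fun _ hx =>
    hf _ (image_eq_zero_of_notMem_tsupport fun h => hx (hs h))

theorem hasWeakDeriv_prim (c : ℝ) {h : ℝ → ℝ} (hh : MemL2loc univ h) (I : Set ℝ) :
    HasWeakDeriv I 1 (prim c h) h := by
  intro φ hφ hs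
  have hd : ∀ x, fderiv ℝ φ x 1 = deriv φ x := fun x => fderiv_apply_one_eq_deriv
  have hs' : tsupport (fun x => fderiv ℝ φ x 1) ⊆ I :=
    (tsupport_fderiv_apply_subset ℝ 1).trans hs
  rw [setIntegral_eq_integral_of_tsupport_subset hs' fun x hx => by rw [hx, mul_zero],
    setIntegral_eq_integral_of_tsupport_subset hs fun x hx => by rw [hx, mul_zero]]
  have i1 : Integrable fun x => prim c h x * fderiv ℝ φ x 1 := by
    rw [← integrableOn_univ]
    exact (memL2loc_of_continuous (continuous_prim c hh)).integrableOn_mul_fderiv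
      MeasurableSet.univ hφ 1
  have i2 : Integrable fun x => h x * φ x := by
    rw [← integrableOn_univ]
    exact hh.integrableOn_mul_testFunction MeasurableSet.univ hφ
  rw [eq_neg_iff_add_eq_zero, ← integral_add i1 i2]
  obtain ⟨R, hR⟩ := hφ.2.isCompact.isBounded.subset_ball 0
  have hz : ∀ x, x ∉ Ioo (-R) R → x ∉ tsupport φ := fun x hx hx' => by
    have := hR hx'
    rw [Real.ball_eq_Ioo] at this
    exact hx (by simpa using this)
  have hsub : Function.support (fun x => prim c h x * fderiv ℝ φ x 1 + h x * φ x) ⊆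
      Ioc (-R) R := by
    intro x hx
    by_contra hcon
    have h0 := hz x fun h => hcon (Ioo_subset_Ioc_self h)
    apply hx
    have h1 : fderiv ℝ φ x 1 = 0 :=
      image_eq_zero_of_notMem_tsupport (f := fun x => fderiv ℝ φ x 1)
        fun h => h0 (tsupport_fderiv_apply_subset ℝ 1 h)
    simp [h1, image_eq_zero_of_notMem_tsupport h0]
  rw [← intervalIntegral.integral_eq_integral_of_support_subset hsub]
  have := integral_prim_mul_deriv c hh (ψ := φ) (ψ' := fun x => fderiv ℝ φ x 1)
    (fun x => by rw [hd]; exact (hφ.differentiable x).hasDerivAt)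
    (hφ.fderiv_apply 1).continuous (-R) R
  rw [image_eq_zero_of_notMem_tsupport (hz R (by simp)),
    image_eq_zero_of_notMem_tsupport (hz (-R) (by simp)), mul_zero, mul_zero, sub_zero] at this
  rw [← this]
  exact intervalIntegral.integral_congr fun x _ => add_comm _ _

theorem isH1loc_prim (c : ℝ) {h : ℝ → ℝ} (hh : MemL2loc univ h) (I : Set ℝ) :
    IsH1loc I (prim c h) h :=
  ⟨memL2loc_of_continuous (continuous_prim c hh), hh.mono (subset_univ _),
    hasWeakDeriv_prim c hh I⟩

/-- Subtracting a primitive of `g` leaves a function with zero weak derivative on an interval. -/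
theorem HasWeakDeriv.ae_eq_prim {I : Set ℝ} (hI : IsOpen I) (hc : Convex ℝ I) {u g : ℝ → ℝ}
    (hu : MemL2loc I u) (hg : MemL2loc I g) (hw : HasWeakDeriv I 1 u g) :
    ∃ c, ∀ᵐ x ∂(volume.restrict I), u x = prim c (I.indicator g) x := by
  have hm := hI.measurableSet
  have hg' := (memL2loc_iff_indicator hm).1 hg
  have hp : MemL2loc I (prim 0 (I.indicator g)) := memL2loc_of_continuous (continuous_prim 0 hg')
  obtain ⟨c, hc⟩ := ae_eq_const_of_weakDeriv_eq_zero (U := fun x => u x - prim 0 (I.indicator g) x)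
    hI hc ((hu.sub hp).locallyIntegrable_indicator hm) (by
      intro v φ hφ hs
      have h1 : ∀ y, fderiv ℝ φ y v = v * fderiv ℝ φ y 1 := fun y => by
        rw [← smul_eq_mul, ← map_smul]; simp
      have e : ∀ y, (u y - prim 0 (I.indicator g) y) * fderiv ℝ φ y v =
          v * (u y * fderiv ℝ φ y 1 - prim 0 (I.indicator g) y * fderiv ℝ φ y 1) := fun y => by
        rw [h1]; ring
      simp only [e]
      rw [integral_const_mul, integral_sub (hu.integrableOn_mul_fderiv hm hφ 1)
        (hp.integrableOn_mul_fderiv hm hφ 1), hw φ hφ hs, hasWeakDeriv_prim 0 hg' I φ hφ hs,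
        setIntegral_congr_fun (f := fun z => I.indicator g z * φ z) (g := fun z => g z * φ z) hm
          fun x hx => by simp [indicator_of_mem hx]]
      simp)
  refine ⟨c, ?_⟩
  filter_upwards [hc] with x hx
  rw [prim] at hx ⊢
  linarith

theorem ae_eq_zero_of_integral_mul_testFunction {I : Set ℝ} (hI : IsOpen I) {g : ℝ → ℝ}
    (hg : LocallyIntegrableOn g I)
    (h : ∀ θ : ℝ → ℝ, IsTestFunction θ → tsupport θ ⊆ I → ∫ x in I, g x * θ x = 0) :
    ∀ᵐ x ∂(volume.restrict I), g x = 0 := by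
  rw [ae_restrict_iff' hI.measurableSet]
  refine hI.ae_eq_zero_of_integral_contDiff_smul_eq_zero hg fun θ h1 h2 h3 => ?_
  rw [← h θ ⟨h1, h2⟩ h3, setIntegral_eq_integral_of_tsupport_subset h3
    fun x hx => by rw [hx, mul_zero]]
  simp [mul_comm]

theorem MemL2loc.locallyIntegrableOn {I : Set ℝ} (hI : MeasurableSet I) {g : ℝ → ℝ}
    (hg : MemL2loc I g) : LocallyIntegrableOn g I :=
  locallyIntegrableOn_of_locallyIntegrable_restrict fun x => by
    obtain ⟨s, hs, hi⟩ := hg.locallyIntegrable_indicator hI x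
    refine ⟨s, hs, ?_⟩
    rw [IntegrableOn, ← Measure.restrict_comm hI]
    exact (integrable_indicator_iff hI).1 hi

theorem ae_eq_of_integral_mul_testFunction {I : Set ℝ} (hI : IsOpen I) {g₁ g₂ : ℝ → ℝ}
    (h₁ : MemL2loc I g₁) (h₂ : MemL2loc I g₂)
    (h : ∀ θ : ℝ → ℝ, IsTestFunction θ → tsupport θ ⊆ I →
      ∫ x in I, g₁ x * θ x = ∫ x in I, g₂ x * θ x) :
    ∀ᵐ x ∂(volume.restrict I), g₁ x = g₂ x := by
  have hm := hI.measurableSet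
  have := ae_eq_zero_of_integral_mul_testFunction hI ((h₁.sub h₂).locallyIntegrableOn hm)
    fun θ hθ hs => by
      simp only [sub_mul]
      rw [integral_sub (h₁.integrableOn_mul_testFunction hm hθ)
        (h₂.integrableOn_mul_testFunction hm hθ), h θ hθ hs, sub_self]
  filter_upwards [this] with x hx
  linarith

theorem HasWeakDeriv.ae_unique {I : Set ℝ} (hI : IsOpen I) {u v g h : ℝ → ℝ}
    (hg : MemL2loc I g) (hh : MemL2loc I h) (huv : ∀ᵐ x ∂(volume.restrict I), u x = v x)
    (hu : HasWeakDeriv I 1 u g) (hv : HasWeakDeriv I 1 v h) :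
    ∀ᵐ x ∂(volume.restrict I), g x = h x := by
  refine ae_eq_of_integral_mul_testFunction hI hg hh fun θ hθ hs => ?_
  rw [← neg_inj, ← hu θ hθ hs, ← hv θ hθ hs]
  refine integral_congr_ae ?_
  filter_upwards [huv] with x hx
  rw [hx]

end Primitive

/-! ### Geometry of the domain -/

theorem isOpen_Q (k : ℝ) : IsOpen (Q k) :=
  (isOpen_lt continuous_const continuous_fst).inter
    ((isOpen_lt continuous_fst (by fun_prop)).inter (isOpen_lt continuous_const continuous_snd))

theorem measurableSet_Q (k : ℝ) : MeasurableSet (Q k) := (isOpen_Q k).measurableSet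

theorem convex_Q (k : ℝ) : Convex ℝ (Q k) := by
  rintro ⟨x, t⟩ ⟨h1, h2, h3⟩ ⟨y, s⟩ ⟨h4, h5, h6⟩ a b ha hb hab
  simp only at h1 h2 h3 h4 h5 h6
  have key {p q : ℝ} (hp : 0 < p) (hq : 0 < q) : 0 < a * p + b * q := by
    rcases ha.eq_or_lt with rfl | ha'
    · rw [zero_add] at hab; subst hab; linarith
    · have := mul_pos ha' hp
      have := mul_nonneg hb hq.le
      linarith
  refine ⟨?_, ?_, ?_⟩
  · simpa using key h1 h4
  · have := key (sub_pos.2 h2) (sub_pos.2 h5)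
    have e : b = 1 - a := by linarith
    subst e
    simp only [Prod.smul_mk, Prod.mk_add_mk, smul_eq_mul]
    linarith
  · simpa using key h3 h6

/-! ### Slicing the domain along parallel lines -/

section Shear

/-- In the coordinates `(x, ξ)` with `ξ = t + σ x`, the shear gives back `(x, t)`. -/
theorem measurePreserving_shear (σ : ℝ) :
    MeasurePreserving (fun p : ℝ × ℝ => (p.1, p.2 - σ * p.1)) :=
  (MeasurePreserving.id (volume : Measure ℝ)).skew_product (g := fun x ξ => ξ - σ * x)
    (by fun_prop) (Eventually.of_forall fun x => by
      have := (measurePreserving_sub_right (volume : Measure ℝ) (σ * x)).map_eq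
      exact this)

/-- In the coordinates `(x, ξ)` the compact set lies in a product of compact sets and the function
depends on `ξ` alone; the shear preserves area. -/
theorem memL2loc_comp_char {h : ℝ → ℝ} (hh : MemL2loc univ h) (σ : ℝ) (Ω : Set (ℝ × ℝ)) :
    MemL2loc Ω (fun z => h (z.2 + σ * z.1)) := by
  suffices H : MemL2loc univ (fun z : ℝ × ℝ => h (z.2 + σ * z.1)) from H.mono (subset_univ _)
  rw [memL2loc_univ] at hh ⊢
  intro K hK
  set K₁ := Prod.fst '' K with hK₁
  set K₂ := (fun z : ℝ × ℝ => z.2 + σ * z.1) '' K with hK₂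
  have c₁ : IsCompact K₁ := hK.image continuous_fst
  have c₂ : IsCompact K₂ := hK.image (by fun_prop)
  have : IsFiniteMeasure (volume.restrict K₁) := ⟨by simpa using c₁.measure_lt_top⟩
  have h1 := (hh K₂ c₂).comp_snd (volume.restrict K₁)
  rw [Measure.prod_restrict] at h1
  have mp := (measurePreserving_shear (-σ)).restrict_preimage
    (c₁.measurableSet.prod c₂.measurableSet)
  have h2 := h1.comp_measurePreserving mp
  have hsub : K ⊆ (fun p : ℝ × ℝ => (p.1, p.2 - -σ * p.1)) ⁻¹' (K₁ ×ˢ K₂) := fun z hz =>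
    ⟨⟨z, hz, rfl⟩, ⟨z, hz, by ring⟩⟩
  refine (h2.mono_measure (Measure.restrict_mono hsub le_rfl)).ae_eq (Eventually.of_forall ?_)
  intro z
  simp only [Function.comp]
  congr 1
  ring

/-- `S`, `lo`, `hi` describe the intersections of `Q k` with the lines `t + σ x = ξ`. -/
structure IsSlicing (k σ : ℝ) (S : Set ℝ) (lo hi : ℝ → ℝ) : Prop where
  measurableSet : MeasurableSet S
  measurable_lo : Measurable lo
  measurable_hi : Measurable hi
  mem_iff : ∀ ξ x, (x, ξ - σ * x) ∈ Q k ↔ ξ ∈ S ∧ lo ξ < x ∧ x < hi ξ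
  lt : ∀ ξ ∈ S, lo ξ < hi ξ

variable {k σ : ℝ} {S : Set ℝ} {lo hi : ℝ → ℝ}

theorem isSlicing_zero (hk : 0 < k) : IsSlicing k 0 (Ioi 0) (fun _ => 0) (fun ξ => 1 + k * ξ) where
  measurableSet := measurableSet_Ioi
  measurable_lo := by fun_prop
  measurable_hi := by fun_prop
  mem_iff ξ x := by simp [Q]; tauto
  lt ξ hξ := by
    have := mul_pos hk hξ
    linarith

/-- The line `t + x = ξ` starts at `x = 0` and leaves through the bottom if `ξ ≤ 1`, through the
moving boundary if `ξ ≥ 1`; the minimum selects the exit. -/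
theorem isSlicing_one (hk : 0 < k) :
    IsSlicing k 1 (Ioi 0) (fun _ => 0) (fun ξ => min ξ ((1 + k * ξ) / (1 + k))) where
  measurableSet := measurableSet_Ioi
  measurable_lo := by fun_prop
  measurable_hi := by fun_prop
  mem_iff ξ x := by
    have h : 0 < 1 + k := by linarith
    simp only [Q, mem_ofPred_eq, mem_Ioi, lt_min_iff, lt_div_iff₀ h]
    constructor
    · rintro ⟨h1, h2, h3⟩
      refine ⟨by linarith, h1, by linarith, by linarith⟩
    · rintro ⟨_, h1, h2, h3⟩
      exact ⟨h1, by linarith, by linarith⟩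
  lt ξ hξ := by
    have : 0 < 1 + k := by linarith
    have hξ' : 0 < ξ := hξ
    exact lt_min hξ' (by positivity)

/-- The line `t - x = ξ` starts on the bottom if `ξ < 0` and at `x = 0` otherwise. It always ends on
the moving boundary, which is slower than the characteristics because `k < 1`. -/
theorem isSlicing_neg_one (hk : 0 < k) (hk1 : k < 1) :
    IsSlicing k (-1) (Ioi (-1)) (fun ξ => max 0 (-ξ)) (fun ξ => (1 + k * ξ) / (1 - k)) where
  measurableSet := measurableSet_Ioi
  measurable_lo := by fun_prop
  measurable_hi := by fun_prop
  mem_iff ξ x := by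
    have h : 0 < 1 - k := by linarith
    simp only [Q, mem_ofPred_eq, mem_Ioi, max_lt_iff, lt_div_iff₀ h]
    constructor
    · rintro ⟨h1, h2, h3⟩
      refine ⟨?_, ⟨h1, by linarith⟩, by linarith⟩
      by_contra hcon
      push Not at hcon
      nlinarith
    · rintro ⟨_, ⟨h1, h2⟩, h3⟩
      exact ⟨h1, by linarith, by linarith⟩
  lt ξ hξ := by
    have h : 0 < 1 - k := by linarith
    have hξ' : -1 < ξ := hξ
    refine max_lt ?_ ?_
    · exact div_pos (by nlinarith) h
    · rw [lt_div_iff₀ h]; nlinarith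

/-- Fubini after the area-preserving shear. All Green formulas below are instances, with the inner
integral computed on each line. -/
theorem IsSlicing.setIntegral_eq (hs : IsSlicing k σ S lo hi) {W : ℝ × ℝ → ℝ}
    (hW : IntegrableOn W (Q k)) {B : ℝ → ℝ}
    (hB : ∀ ξ ∈ S, ∫ x in lo ξ..hi ξ, W (x, ξ - σ * x) = B ξ) :
    ∫ z in Q k, W z = ∫ ξ in S, B ξ := by
  have mp := measurePreserving_shear σ
  have hm := measurableSet_Q k
  have hi' : Integrable ((Q k).indicator W) := (integrable_indicator_iff hm).2 hW
  have hi'' : Integrable (fun p : ℝ × ℝ => (Q k).indicator W (p.1, p.2 - σ * p.1)) :=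
    mp.integrable_comp_of_integrable hi'
  have e : ∫ z, (Q k).indicator W z = ∫ p : ℝ × ℝ, (Q k).indicator W (p.1, p.2 - σ * p.1) := by
    conv_lhs => rw [← mp.map_eq]
    exact integral_map mp.aemeasurable (by rw [mp.map_eq]; exact hi'.aestronglyMeasurable)
  rw [← integral_indicator hm, e, Measure.volume_eq_prod, integral_prod_symm _ hi'',
    ← integral_indicator hs.measurableSet]
  refine integral_congr_ae (Eventually.of_forall fun ξ => ?_)
  by_cases hξ : ξ ∈ S
  · simp only [indicator_of_mem hξ]
    rw [← hB ξ hξ, intervalIntegral.integral_of_le (hs.lt ξ hξ).le, integral_Ioc_eq_integral_Ioo,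
      ← integral_indicator measurableSet_Ioo]
    refine integral_congr_ae (Eventually.of_forall fun x => ?_)
    by_cases hx : (x, ξ - σ * x) ∈ Q k
    · have : x ∈ Ioo (lo ξ) (hi ξ) := ((hs.mem_iff ξ x).1 hx).2
      simp only [indicator_of_mem this, indicator_of_mem hx]
    · have : x ∉ Ioo (lo ξ) (hi ξ) := fun h => hx ((hs.mem_iff ξ x).2 ⟨hξ, h⟩)
      simp only [indicator_of_notMem this, indicator_of_notMem hx]
  · simp only [indicator_of_notMem hξ]
    refine integral_eq_zero_of_ae (Eventually.of_forall fun x => ?_)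
    exact indicator_of_notMem (fun h => hξ ((hs.mem_iff ξ x).1 h).1) _

theorem hasDerivAt_along_line {φ : ℝ × ℝ → ℝ} (hφ : IsTestFunction φ) (ξ σ x : ℝ) :
    HasDerivAt (fun x => φ (x, ξ - σ * x)) (fderiv ℝ φ (x, ξ - σ * x) (1, -σ)) x := by
  have h1 : HasDerivAt (fun x : ℝ => (x, ξ - σ * x)) (1, -σ) x :=
    (hasDerivAt_id x).prodMk (by simpa using ((hasDerivAt_id x).const_mul σ).const_sub ξ)
  exact (hφ.differentiable _).hasFDerivAt.comp_hasDerivAt x h1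

theorem continuous_fderiv_along_line {φ : ℝ × ℝ → ℝ} (hφ : IsTestFunction φ) (ξ σ : ℝ) :
    Continuous (fun x => fderiv ℝ φ (x, ξ - σ * x) (1, -σ)) :=
  (hφ.fderiv_apply (1, -σ)).continuous.comp (by fun_prop)

/-- Green's formula for a function that is constant along the lines `t + σ x = ξ`. -/
theorem IsSlicing.integral_char_mul_fderiv (hs : IsSlicing k σ S lo hi) {h : ℝ → ℝ}
    {φ : ℝ × ℝ → ℝ} (hφ : IsTestFunction φ)
    (hi' : IntegrableOn (fun z => h (z.2 + σ * z.1) * fderiv ℝ φ z (1, -σ)) (Q k)) :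
    ∫ z in Q k, h (z.2 + σ * z.1) * fderiv ℝ φ z (1, -σ) =
      ∫ ξ in S, h ξ * (φ (hi ξ, ξ - σ * hi ξ) - φ (lo ξ, ξ - σ * lo ξ)) := by
  refine hs.setIntegral_eq hi' fun ξ _ => ?_
  simp only [sub_add_cancel]
  rw [intervalIntegral.integral_const_mul, intervalIntegral.integral_eq_sub_of_hasDerivAt
    (fun x _ => hasDerivAt_along_line hφ ξ σ x)
    ((continuous_fderiv_along_line hφ ξ σ).intervalIntegrable _ _)]

end Shear

/-! ### Waves and Green's formula along lines -/

section Waves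

/-- The d'Alembert wave `(x, t) ↦ f (t + x) + f (t - x)`. -/
def wave (f : ℝ → ℝ) (z : ℝ × ℝ) : ℝ := f (z.2 + z.1) + f (z.2 - z.1)

/-- The space derivative of `wave f`, where `h` is the derivative of `f`. -/
def waveX (h : ℝ → ℝ) (z : ℝ × ℝ) : ℝ := h (z.2 + z.1) - h (z.2 - z.1)

theorem memL2loc_wave {h : ℝ → ℝ} (hh : MemL2loc univ h) (Ω : Set (ℝ × ℝ)) : MemL2loc Ω (wave h) := by
  have := (memL2loc_comp_char hh 1 Ω).add (memL2loc_comp_char hh (-1) Ω)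
  simp only [one_mul, neg_one_mul, ← sub_eq_add_neg] at this
  exact this

theorem memL2loc_waveX {h : ℝ → ℝ} (hh : MemL2loc univ h) (Ω : Set (ℝ × ℝ)) : MemL2loc Ω (waveX h) := by
  have := (memL2loc_comp_char hh 1 Ω).sub (memL2loc_comp_char hh (-1) Ω)
  simp only [one_mul, neg_one_mul, ← sub_eq_add_neg] at this
  exact this

theorem memL2loc_wave_prim {h : ℝ → ℝ} (hh : MemL2loc univ h) (c : ℝ) (Ω : Set (ℝ × ℝ)) : MemL2loc Ω (wave (prim c h)) := by
  have := continuous_prim c hh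
  exact memL2loc_of_continuous (by unfold wave; fun_prop)

/-- On the line `t = ξ - σ x` the two travelling parts are primitives composed with affine maps of
slopes `1 - σ` and `-1 - σ`. Integration by parts for each, added up, gives the formula. -/
theorem integral_wave_along_line {h : ℝ → ℝ} (hh : MemL2loc univ h)
    (c : ℝ) {φ : ℝ × ℝ → ℝ} (hφ : IsTestFunction φ) (ξ σ a b : ℝ) :
    ∫ x in a..b, ((waveX h (x, ξ - σ * x) - σ * wave h (x, ξ - σ * x)) * φ (x, ξ - σ * x) +
        wave (prim c h) (x, ξ - σ * x) * fderiv ℝ φ (x, ξ - σ * x) (1, -σ)) =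
      wave (prim c h) (b, ξ - σ * b) * φ (b, ξ - σ * b) -
        wave (prim c h) (a, ξ - σ * a) * φ (a, ξ - σ * a) := by
  have hd := hasDerivAt_along_line hφ ξ σ
  have hc := continuous_fderiv_along_line hφ ξ σ
  have hφc : Continuous fun x : ℝ => φ (x, ξ - σ * x) := hφ.continuous.comp (by fun_prop)
  have ii (m : ℝ) : IntervalIntegrable (fun x => m * h (ξ + m * x) * φ (x, ξ - σ * x) +
      prim c h (ξ + m * x) * fderiv ℝ φ (x, ξ - σ * x) (1, -σ)) volume a b :=
    (((hh.const_mul_comp_affine ξ m).intervalIntegrable a b).mul_continuousOn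
      hφc.continuousOn).add (Continuous.intervalIntegrable
        (((continuous_prim c hh).comp (by fun_prop)).mul hc) _ _)
  have e₁ := integral_prim_comp_affine_mul_deriv c hh hd hc ξ (1 - σ) a b
  have e₂ := integral_prim_comp_affine_mul_deriv c hh hd hc ξ (-1 - σ) a b
  have hp (x : ℝ) : ξ - σ * x + x = ξ + (1 - σ) * x := by ring
  have hm (x : ℝ) : ξ - σ * x - x = ξ + (-1 - σ) * x := by ring
  have := congr_arg₂ (· + ·) e₁ e₂
  simp only [← intervalIntegral.integral_add (ii _) (ii _)] at this
  simp only [wave, waveX, hp, hm]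
  convert this using 1
  · exact intervalIntegral.integral_congr fun x _ => by ring
  · ring

theorem IsSlicing.integral_wave {h : ℝ → ℝ} (hh : MemL2loc univ h)
    {k σ : ℝ} {S : Set ℝ} {lo hi : ℝ → ℝ}
    (hs : IsSlicing k σ S lo hi) (c : ℝ) {φ : ℝ × ℝ → ℝ} (hφ : IsTestFunction φ) :
    ∫ z in Q k, ((waveX h z - σ * wave h z) * φ z +
        wave (prim c h) z * fderiv ℝ φ z (1, -σ)) =
      ∫ ξ in S, (wave (prim c h) (hi ξ, ξ - σ * hi ξ) * φ (hi ξ, ξ - σ * hi ξ) -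
        wave (prim c h) (lo ξ, ξ - σ * lo ξ) * φ (lo ξ, ξ - σ * lo ξ)) := by
  have hm := measurableSet_Q k
  refine hs.setIntegral_eq ?_ fun ξ _ => integral_wave_along_line hh c hφ ξ σ _ _
  exact (((memL2loc_waveX hh _).sub ((memL2loc_wave hh _).const_mul σ)).integrableOn_mul_testFunction
    hm hφ).add ((memL2loc_wave_prim hh c _).integrableOn_mul_fderiv hm hφ _)

end Waves

/-! ### Affine substitutions in integrals -/

section Substitution

theorem mul_integral_Ioi_comp_affine (g : ℝ → ℝ) (b : ℝ) {m : ℝ} (hm : 0 < m) :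
    m * ∫ t in Ioi (0 : ℝ), g (b + m * t) = ∫ ξ in Ioi b, g ξ := by
  have h1 := Measure.integral_comp_mul_left (fun x => (Ioi b).indicator g (b + x)) m
  rw [integral_add_left_eq_self (fun x => (Ioi b).indicator g x) b,
    integral_indicator measurableSet_Ioi] at h1
  have h2 : ∀ t, (Ioi b).indicator g (b + m * t) =
      (Ioi (0 : ℝ)).indicator (fun t => g (b + m * t)) t := fun t => by
    have : b + m * t ∈ Ioi b ↔ t ∈ Ioi (0 : ℝ) := by simp [hm]
    simp only [indicator, this]
  simp only [h2] at h1
  rw [integral_indicator measurableSet_Ioi] at h1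
  rw [h1, abs_of_pos (inv_pos.2 hm), smul_eq_mul, ← mul_assoc, mul_inv_cancel₀ hm.ne', one_mul]

theorem integral_Ioo_comp_neg (g : ℝ → ℝ) (a b : ℝ) :
    ∫ x in Ioo a b, g (-x) = ∫ x in Ioo (-b) (-a), g x := by
  rw [← integral_indicator measurableSet_Ioo, ← integral_indicator measurableSet_Ioo,
    ← integral_neg_eq_self]
  refine integral_congr_ae (Eventually.of_forall fun x => ?_)
  have : -x ∈ Ioo a b ↔ x ∈ Ioo (-b) (-a) := by
    simp only [mem_Ioo]; constructor <;> rintro ⟨_, _⟩ <;> constructor <;> linarith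
  show (Ioo a b).indicator (fun x => g (-x)) (-x) = _
  by_cases hx : x ∈ Ioo (-b) (-a)
  · rw [indicator_of_mem hx, indicator_of_mem (this.2 hx), neg_neg]
  · rw [indicator_of_notMem hx, indicator_of_notMem (mt this.1 hx)]

end Substitution

theorem fderiv_comb (φ : ℝ × ℝ → ℝ) (z : ℝ × ℝ) (σ : ℝ) :
    fderiv ℝ φ z (1, -σ) = fderiv ℝ φ z (1, 0) - σ * fderiv ℝ φ z (0, 1) := by
  have : ((1 : ℝ), -σ) = (1, 0) - σ • ((0 : ℝ), (1 : ℝ)) := by simp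
  rw [this, map_sub, map_smul, smul_eq_mul]

/-! ### A profile satisfying the functional equation gives a weak solution -/

section Forward

variable {k : ℝ} {h : ℝ → ℝ}

theorem integral_waveX_mul (hk : 0 < k) (hh : MemL2loc univ h) (c : ℝ) {φ : ℝ × ℝ → ℝ}
    (hφ : IsTestFunction φ) (hs : ∀ t, φ (0, t) = 0) :
    ∫ z in Q k, (waveX h z * φ z + wave (prim c h) z * fderiv ℝ φ z (1, 0)) =
      ∫ t in Ioi (0 : ℝ), wave (prim c h) (1 + k * t, t) * φ (1 + k * t, t) := by
  have := (isSlicing_zero hk).integral_wave hh c hφ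
  simpa [hs] using this

/-- Since `(0, 1) = (1, 1) - (1, 0)`, this is the formula along `t - x = ξ` minus the one along
horizontal lines. The hypotheses on `φ` remove all endpoints except those on the bottom. They cover
both test functions supported in `Q k` and those supported in the strip `0 < x < 1`. -/
theorem integral_wave_mul (hk : 0 < k) (hk1 : k < 1) (hh : MemL2loc univ h) (c : ℝ)
    {φ : ℝ × ℝ → ℝ} (hφ : IsTestFunction φ) (hs : ∀ t, φ (0, t) = 0)
    (hs' : ∀ x t, 1 ≤ x → (x, t) ∉ Q k → φ (x, t) = 0) :
    ∫ z in Q k, (wave h z * φ z + wave (prim c h) z * fderiv ℝ φ z (0, 1)) =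
      - ∫ x in Ioo (0 : ℝ) 1, wave (prim c h) (x, 0) * φ (x, 0) := by
  have hm := measurableSet_Q k
  have e0 := (isSlicing_zero hk).integral_wave hh c hφ
  have e1 := (isSlicing_neg_one hk hk1).integral_wave hh c hφ
  have z0 : ∀ ξ ∈ Ioi (0 : ℝ), wave (prim c h) (1 + k * ξ, ξ - 0 * (1 + k * ξ)) *
      φ (1 + k * ξ, ξ - 0 * (1 + k * ξ)) -
        wave (prim c h) (0, ξ - 0 * 0) * φ (0, ξ - 0 * 0) = 0 := fun ξ hξ => by
    have hξ' : 0 < ξ := hξ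
    rw [hs, hs' _ _ (by nlinarith) (by simp [Q]), mul_zero, mul_zero, sub_zero]
  rw [setIntegral_congr_fun measurableSet_Ioi z0, integral_zero] at e0
  have hk1' : 0 < 1 - k := by linarith
  have z1 : ∀ ξ ∈ Ioi (-1 : ℝ), wave (prim c h) ((1 + k * ξ) / (1 - k),
        ξ - -1 * ((1 + k * ξ) / (1 - k))) *
      φ ((1 + k * ξ) / (1 - k), ξ - -1 * ((1 + k * ξ) / (1 - k))) -
        wave (prim c h) (max 0 (-ξ), ξ - -1 * max 0 (-ξ)) *
          φ (max 0 (-ξ), ξ - -1 * max 0 (-ξ)) =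
      (Ioo (-1 : ℝ) 0).indicator (fun y => -(wave (prim c h) (-y, 0) * φ (-y, 0))) ξ := by
    intro ξ hξ
    have hξ' : -1 < ξ := hξ
    have hb : φ ((1 + k * ξ) / (1 - k), ξ - -1 * ((1 + k * ξ) / (1 - k))) = 0 := by
      refine hs' _ _ ?_ ?_
      · rw [le_div_iff₀ hk1']; nlinarith
      · rw [(isSlicing_neg_one hk hk1).mem_iff]
        simp
    rw [hb, mul_zero, zero_sub]
    by_cases hξ0 : ξ < 0
    · rw [indicator_of_mem (show ξ ∈ Ioo (-1 : ℝ) 0 from ⟨hξ, hξ0⟩), max_eq_right (by linarith)]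
      simp
    · rw [indicator_of_notMem (fun hmem => hξ0 hmem.2), max_eq_left (by linarith), hs]
      simp
  rw [setIntegral_congr_fun measurableSet_Ioi z1, setIntegral_indicator measurableSet_Ioo,
    inter_eq_right.2 (fun x hx => hx.1), integral_neg] at e1
  have e2 := integral_Ioo_comp_neg (fun x => wave (prim c h) (x, 0) * φ (x, 0)) (-1) 0
  rw [neg_neg, neg_zero] at e2
  rw [e2] at e1
  have hint (σ : ℝ) : IntegrableOn (fun z => (waveX h z - σ * wave h z) * φ z +
      wave (prim c h) z * fderiv ℝ φ z (1, -σ)) (Q k) :=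
    (((memL2loc_waveX hh _).sub ((memL2loc_wave hh _).const_mul _)).integrableOn_mul_testFunction
      hm hφ).add ((memL2loc_wave_prim hh c _).integrableOn_mul_fderiv hm hφ _)
  have e3 := integral_sub (hint (-1)) (hint 0)
  rw [e0, e1, sub_zero] at e3
  rw [← e3]
  refine setIntegral_congr_fun hm fun z _ => ?_
  simp only [fderiv_comb φ z (-1), fderiv_comb φ z 0]
  ring

theorem isH1locPlane_wave (hk : 0 < k) (hk1 : k < 1) (hh : MemL2loc univ h) (c : ℝ) :
    IsH1locPlane (Q k) (wave (prim c h)) (waveX h) (wave h) := by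
  have hm := measurableSet_Q k
  refine ⟨memL2loc_wave_prim hh c _, memL2loc_waveX hh _, memL2loc_wave hh _, ?_, ?_⟩ <;>
  intro φ hφ hs <;>
  have hz : ∀ z, z ∉ Q k → φ z = 0 := fun z hz => image_eq_zero_of_notMem_tsupport fun h => hz (hs h)
  · have := integral_waveX_mul hk hh c hφ fun t => hz _ (by simp [Q])
    simp only [fun t => hz (1 + k * t, t) (by simp [Q]), mul_zero, integral_zero] at this
    rw [integral_add ((memL2loc_waveX hh _).integrableOn_mul_testFunction hm hφ)
      ((memL2loc_wave_prim hh c _).integrableOn_mul_fderiv hm hφ _)] at this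
    linarith
  · have := integral_wave_mul hk hk1 hh c hφ (fun t => hz _ (by simp [Q])) fun x t _ h => hz _ h
    simp only [fun x => hz (x, 0) (by simp [Q]), mul_zero, integral_zero, neg_zero] at this
    rw [integral_add ((memL2loc_wave hh _).integrableOn_mul_testFunction hm hφ)
      ((memL2loc_wave_prim hh c _).integrableOn_mul_fderiv hm hφ _)] at this
    linarith

/-- The map `z ↦ t + σ x` is a continuous left inverse of the section, which is therefore a closed
embedding; so the restricted test function keeps compact support. -/
theorem integrable_mul_comp_section (hh : MemL2loc univ h) {φ : ℝ × ℝ → ℝ}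
    (hφ : IsTestFunction φ) (σ : ℝ) {s : ℝ → ℝ} (hs : Continuous s) :
    Integrable fun ξ => h ξ * φ (s ξ, ξ - σ * s ξ) := by
  have hc : Continuous fun ξ => (s ξ, ξ - σ * s ξ) := by fun_prop
  have hinv : Function.LeftInverse (fun z : ℝ × ℝ => z.2 + σ * z.1) fun ξ => (s ξ, ξ - σ * s ξ) :=
    fun ξ => by simp
  have hemb := hinv.isClosedEmbedding (by fun_prop) hc
  rw [← integrableOn_univ]
  exact hh.integrableOn_mul MeasurableSet.univ (hφ.continuous.comp hc)
    (hφ.2.comp_isClosedEmbedding hemb)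

/-- The integrand equals `h(t - x)(φ_x + φ_t) - h(t + x)(φ_x - φ_t)`, where each factor in `φ` is a
derivative along a characteristic on which the matching factor in `h` is constant. Only endpoint
values remain, and the two contributions from `x = 0` cancel because both parts share one profile:
this is the Neumann condition. -/
theorem integral_wave_green (hk : 0 < k) (hk1 : k < 1) (hh : MemL2loc univ h)
    {φ : ℝ × ℝ → ℝ} (hφ : IsTestFunction φ) :
    (∫ z in Q k, (wave h z * fderiv ℝ φ z (0, 1) - waveX h z * fderiv ℝ φ z (1, 0))) +
      (∫ t in Ioi (0 : ℝ), ((1 + k) * h (1 + (1 + k) * t) - (1 - k) * h (-1 + (1 - k) * t)) *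
        φ (1 + k * t, t)) +
      (∫ x in Ioo (0 : ℝ) 1, (h x + h (-x)) * φ (x, 0)) = 0 := by
  have hm := measurableSet_Q k
  have hp : 0 < 1 + k := by linarith
  have hn : 0 < 1 - k := by linarith
  have i1 := (memL2loc_comp_char hh 1 (Q k)).integrableOn_mul_fderiv hm hφ (1, -1)
  have i2 := (memL2loc_comp_char hh (-1) (Q k)).integrableOn_mul_fderiv hm hφ (1, - -1)
  have e1 := (isSlicing_one hk).integral_char_mul_fderiv hφ i1
  have e2 := (isSlicing_neg_one hk hk1).integral_char_mul_fderiv hφ i2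
  have hI : ∫ z in Q k, (wave h z * fderiv ℝ φ z (0, 1) - waveX h z * fderiv ℝ φ z (1, 0)) =
      (∫ z in Q k, h (z.2 + -1 * z.1) * fderiv ℝ φ z (1, - -1)) -
        ∫ z in Q k, h (z.2 + 1 * z.1) * fderiv ℝ φ z (1, -1) := by
    rw [← integral_sub i2 i1]
    refine setIntegral_congr_fun hm fun z _ => ?_
    simp only [fderiv_comb φ z (-1), fderiv_comb φ z 1, wave, waveX, one_mul, neg_one_mul,
      ← sub_eq_add_neg]
    ring
  have hsec {σ : ℝ} {s : ℝ → ℝ} (hs : Continuous s) := integrable_mul_comp_section hh hφ σ hs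
  have c1 : Continuous fun ξ : ℝ => min ξ ((1 + k * ξ) / (1 + k)) := by fun_prop
  have c2 : Continuous fun ξ : ℝ => (1 + k * ξ) / (1 + k) := by fun_prop
  have c3 : Continuous fun ξ : ℝ => (1 + k * ξ) / (1 - k) := by fun_prop
  have c4 : Continuous fun ξ : ℝ => max 0 (-ξ) := by fun_prop
  have c0 : Continuous fun _ : ℝ => (0 : ℝ) := continuous_const
  simp only [mul_sub] at e1 e2
  rw [integral_sub (hsec c1).integrableOn (hsec c0).integrableOn] at e1
  rw [integral_sub (hsec c3).integrableOn (hsec c4).integrableOn] at e2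
  have u1 : Ioi (0 : ℝ) = Ioo 0 1 ∪ Ici 1 :=
    (@Ioo_union_Ici_eq_Ioi ℝ _ 0 1 (by norm_num)).symm
  have u2 : Ioi (-1 : ℝ) = Ioo (-1) 0 ∪ Ici 0 :=
    (Ioo_union_Ici_eq_Ioi (show (-1 : ℝ) < 0 by norm_num)).symm
  have hdisj (p q : ℝ) : Disjoint (Ioo p q) (Ici q) :=
    disjoint_left.2 fun x h1 h2 => not_lt_of_ge h2 h1.2
  have s1 : ∫ ξ in Ioi (0 : ℝ), h ξ * φ (min ξ ((1 + k * ξ) / (1 + k)),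
        ξ - 1 * min ξ ((1 + k * ξ) / (1 + k))) =
      (∫ x in Ioo (0 : ℝ) 1, h x * φ (x, 0)) +
        (1 + k) * ∫ t in Ioi (0 : ℝ), h (1 + (1 + k) * t) * φ (1 + k * t, t) := by
    conv_lhs => rw [u1]
    rw [setIntegral_union (hdisj _ _) measurableSet_Ici
      (hsec c1).integrableOn (hsec c1).integrableOn]
    congr 1
    · refine setIntegral_congr_fun measurableSet_Ioo fun ξ hξ => ?_
      have : ξ ≤ (1 + k * ξ) / (1 + k) := by rw [le_div_iff₀ hp]; nlinarith [hξ.2]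
      simp [min_eq_left this]
    -- For `ξ ≥ 1` the exit lies on the moving boundary at time `t`, where `ξ = t + l(t) = 1 + (1 +
    -- k) t`.
    · rw [integral_Ici_eq_integral_Ioi, ← mul_integral_Ioi_comp_affine _ 1 hp]
      congr 1
      refine setIntegral_congr_fun measurableSet_Ioi fun t ht => ?_
      have ht' : 0 < t := ht
      have e : (1 + k * (1 + (1 + k) * t)) / (1 + k) = 1 + k * t := by field_simp; ring
      have : min (1 + (1 + k) * t) (1 + k * t) = 1 + k * t := min_eq_right (by nlinarith)
      simp only [e, this]
      congr 3
      ring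
  have s2 : ∫ ξ in Ioi (-1 : ℝ), h ξ * φ ((1 + k * ξ) / (1 - k),
        ξ - -1 * ((1 + k * ξ) / (1 - k))) =
        (1 - k) * ∫ t in Ioi (0 : ℝ), h (-1 + (1 - k) * t) * φ (1 + k * t, t) := by
    rw [← mul_integral_Ioi_comp_affine _ (-1) hn]
    congr 1
    refine setIntegral_congr_fun measurableSet_Ioi fun t ht => ?_
    have e : (1 + k * (-1 + (1 - k) * t)) / (1 - k) = 1 + k * t := by field_simp; ring
    simp only [e]
    congr 3
    ring
  have s3 : ∫ ξ in Ioi (-1 : ℝ), h ξ * φ (max 0 (-ξ), ξ - -1 * max 0 (-ξ)) =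
      (∫ x in Ioo (0 : ℝ) 1, h (-x) * φ (x, 0)) +
        ∫ ξ in Ioi (0 : ℝ), h ξ * φ (0, ξ - 1 * 0) := by
    rw [u2, setIntegral_union (hdisj _ _) measurableSet_Ici
      (hsec c4).integrableOn (hsec c4).integrableOn]
    congr 1
    · have := integral_Ioo_comp_neg (fun x => h (-x) * φ (x, 0)) (-1) 0
      rw [neg_neg, neg_zero] at this
      rw [← this]
      refine setIntegral_congr_fun measurableSet_Ioo fun ξ hξ => ?_
      simp [max_eq_right (show (0 : ℝ) ≤ -ξ by linarith [hξ.2])]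
    · rw [integral_Ici_eq_integral_Ioi]
      refine setIntegral_congr_fun measurableSet_Ioi fun ξ hξ => ?_
      have hξ' : 0 < ξ := hξ
      simp [max_eq_left (show -ξ ≤ (0 : ℝ) by linarith)]
  have j0 : IntegrableOn (fun x => h x * φ (x, 0)) (Ioo 0 1) := by
    have := (hsec (σ := 1) continuous_id).integrableOn (s := Ioo 0 1)
    simpa using this
  have j1 : IntegrableOn (fun x => h (-x) * φ (x, 0)) (Ioo 0 1) := by
    have := (hsec (σ := -1) continuous_neg).comp_neg.integrableOn (s := Ioo 0 1)
    simpa using this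
  have j2 : IntegrableOn (fun t => h (1 + (1 + k) * t) * φ (1 + k * t, t)) (Ioi 0) := by
    have := (((hsec (σ := 1) c2).comp_add_left 1).comp_mul_left' hp.ne').integrableOn (s := Ioi 0)
    refine this.congr_fun (fun t _ => ?_) measurableSet_Ioi
    have e : (1 + k * (1 + (1 + k) * t)) / (1 + k) = 1 + k * t := by field_simp; ring
    simp only [e]
    congr 3
    ring
  have j3 : IntegrableOn (fun t => h (-1 + (1 - k) * t) * φ (1 + k * t, t)) (Ioi 0) := by
    have := (((hsec (σ := -1) c3).comp_add_left (-1)).comp_mul_left' hn.ne').integrableOn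
      (s := Ioi 0)
    refine this.congr_fun (fun t _ => ?_) measurableSet_Ioi
    have e : (1 + k * (-1 + (1 - k) * t)) / (1 - k) = 1 + k * t := by field_simp; ring
    simp only [e]
    congr 3
    ring
  have hJ : ∫ t in Ioi (0 : ℝ), ((1 + k) * h (1 + (1 + k) * t) -
        (1 - k) * h (-1 + (1 - k) * t)) * φ (1 + k * t, t) =
      (1 + k) * (∫ t in Ioi (0 : ℝ), h (1 + (1 + k) * t) * φ (1 + k * t, t)) -
      (1 - k) * ∫ t in Ioi (0 : ℝ), h (-1 + (1 - k) * t) * φ (1 + k * t, t) := by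
    rw [← integral_const_mul, ← integral_const_mul,
      ← integral_sub (j2.const_mul _) (j3.const_mul _)]
    exact integral_congr_ae (Eventually.of_forall fun t => by ring)
  have hK : ∫ x in Ioo (0 : ℝ) 1, (h x + h (-x)) * φ (x, 0) =
      (∫ x in Ioo (0 : ℝ) 1, h x * φ (x, 0)) + ∫ x in Ioo (0 : ℝ) 1, h (-x) * φ (x, 0) := by
    rw [← integral_add j0 j1]
    exact integral_congr_ae (Eventually.of_forall fun t => by ring)
  rw [hI, e1, e2, s1, s2, s3, hJ, hK]
  ring

theorem prim_add_prim (c d : ℝ) {g : ℝ → ℝ} (hg : MemL2loc univ g) (hh : MemL2loc univ h) (x : ℝ) :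
    prim c g x + prim d h x = prim (c + d) (fun y => g y + h y) x := by
  rw [prim, prim, prim, intervalIntegral.integral_add (hg.intervalIntegrable _ _)
    (hh.intervalIntegrable _ _)]
  ring

/-- The trace of `wave (prim c h)` on the moving boundary. -/
theorem exists_wave_moving_eq_prim (hh : MemL2loc univ h) (c k : ℝ) :
    MemL2loc univ (fun t => (1 + k) * h (1 + (1 + k) * t) + (1 - k) * h (-1 + (1 - k) * t)) ∧
    ∃ d, ∀ t, wave (prim c h) (1 + k * t, t) =
      prim d (fun t => (1 + k) * h (1 + (1 + k) * t) + (1 - k) * h (-1 + (1 - k) * t)) t := by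
  have h1 := hh.const_mul_comp_affine 1 (1 + k)
  have h2 := hh.const_mul_comp_affine (-1) (1 - k)
  refine ⟨h1.add h2, prim c h 1 + prim c h (-1), fun t => ?_⟩
  rw [← prim_add_prim (prim c h 1) (prim c h (-1)) h1 h2, ← prim_comp_affine c hh,
    ← prim_comp_affine c hh, wave]
  congr 2 <;> ring

/-- The wave with profile `prim c h` is a weak solution when `h` satisfies the functional
equation of the moving boundary. -/
theorem isWeakSolution_wave (hk : 0 < k) (hk1 : k < 1) {a : ℝ} (hh : MemL2loc univ h) (c : ℝ)
    (hF : ∀ᵐ s ∂(volume.restrict (Ioi (-1 : ℝ))), (1 + a) * h (F k s) = (1 - a) * h s)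
    {u0 u1 : ℝ → ℝ}
    (hu0 : ∀ᵐ x ∂(volume.restrict (Ioo (0 : ℝ) 1)), u0 x = prim c h x + prim c h (-x))
    (hu1 : ∀ᵐ x ∂(volume.restrict (Ioo (0 : ℝ) 1)), u1 x = h x + h (-x)) :
    IsWeakSolution k a u0 u1 (wave (prim c h)) := by
  have hp : 0 < 1 + k := by linarith
  have hn : 0 < 1 - k := by linarith
  have hP := hh.comp_affine 1 hp.ne'
  have hM := hh.comp_affine (-1) hn.ne'
  obtain ⟨hw, d, hd⟩ := exists_wave_moving_eq_prim hh c k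
  -- Here `1 + (1 + k) t = t + l(t)` and `-1 + (1 - k) t = t - l(t)`, so `p` and `q` are the formal
  -- values of `u_t` and `u_x` on the moving boundary.
  refine ⟨waveX h, wave h, fun t => wave (prim c h) (1 + k * t, t),
    fun t => h (1 + (1 + k) * t) + h (-1 + (1 - k) * t),
    fun t => h (1 + (1 + k) * t) - h (-1 + (1 - k) * t), isH1locPlane_wave hk hk1 hh c,
    (hP.add hM).mono (subset_univ _), (hP.sub hM).mono (subset_univ _), ?_, ?_, ?_, ?_, ?_⟩
  · intro φ hφ hs
    have hz : ∀ z : ℝ × ℝ, ¬ (0 < z.1 ∧ z.1 < 1) → φ z = 0 := fun z hz =>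
      image_eq_zero_of_notMem_tsupport fun h => hz (hs h)
    rw [integral_wave_mul hk hk1 hh c hφ (fun t => hz _ (by simp))
      fun x t hx _ => hz _ (by simp [hx])]
    congr 1
    refine integral_congr_ae ?_
    filter_upwards [hu0] with x hx
    rw [hx, wave, zero_add, zero_sub]
  · intro φ hφ hs
    exact integral_waveX_mul hk hh c hφ fun t =>
      image_eq_zero_of_notMem_tsupport fun h => lt_irrefl _ (hs h).1
  · have := isH1loc_prim d hw (Ioi 0)
    rw [show (fun t => wave (prim c h) (1 + k * t, t)) = prim d _ from funext hd]
    convert this using 2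
    ring
  -- The boundary condition is the functional equation at `s = t - l(t)`.
  · rw [ae_restrict_iff' measurableSet_Ioi] at hF ⊢
    filter_upwards [(quasiMeasurePreserving_affine (-1) hn.ne').ae hF] with t ht ht0
    have ht0' : 0 < t := ht0
    have h1 := ht (by simpa using mul_pos hn ht0')
    have h2 : F k (-1 + (1 - k) * t) = 1 + (1 + k) * t := by
      rw [F]; field_simp; ring
    rw [h2] at h1
    linarith
  · intro φ hφ
    refine Eq.trans ?_ (integral_wave_green hk hk1 hh hφ)
    congr 1
    · congr 1
      exact integral_congr_ae (Eventually.of_forall fun t => by ring)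
    · refine integral_congr_ae ?_
      filter_upwards [hu1] with x hx
      rw [hx]

end Forward

/-! ### Constancy along characteristics -/

section Characteristics

variable {k σ : ℝ} {S : Set ℝ} {lo hi : ℝ → ℝ}

/-- The combination `ut + σ ux`, `σ = ± 1`, is weakly constant along characteristics. -/
theorem integral_char_comb_eq_zero {u ux ut : ℝ × ℝ → ℝ} (hu : IsH1locPlane (Q k) u ux ut)
    (hw : ∀ φ : ℝ × ℝ → ℝ, IsTestFunction φ → tsupport φ ⊆ Q k →
      ∫ z in Q k, (ut z * fderiv ℝ φ z (0, 1) - ux z * fderiv ℝ φ z (1, 0)) = 0)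
    (hσ : σ * σ = 1) {φ : ℝ × ℝ → ℝ} (hφ : IsTestFunction φ) (hs : tsupport φ ⊆ Q k) :
    ∫ z in Q k, (ut z + σ * ux z) * fderiv ℝ φ z (1, -σ) = 0 := by
  obtain ⟨-, hx, ht, dx, dt⟩ := hu
  have hm := measurableSet_Q k
  -- Testing `ut` against `φ_x` and `ux` against `φ_t`, together with the symmetry of second
  -- derivatives of `φ`, gives the weak form of `∂_x u_t = ∂_t u_x`.
  have e1 := dt _ (hφ.fderiv_apply (1, 0)) ((tsupport_fderiv_apply_subset ℝ _).trans hs)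
  have e2 := dx _ (hφ.fderiv_apply (0, 1)) ((tsupport_fderiv_apply_subset ℝ _).trans hs)
  simp only [hφ.fderiv_comm (1, 0) (0, 1)] at e1
  have e3 : ∫ z in Q k, ut z * fderiv ℝ φ z (1, 0) = ∫ z in Q k, ux z * fderiv ℝ φ z (0, 1) := by
    linarith
  have i1 := ht.integrableOn_mul_fderiv hm hφ (1, 0)
  have i2 := hx.integrableOn_mul_fderiv hm hφ (0, 1)
  have i3 := (ht.integrableOn_mul_fderiv hm hφ (0, 1)).sub
    (hx.integrableOn_mul_fderiv hm hφ (1, 0))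
  have e4 := integral_sub (i1.sub i2) (i3.const_mul σ)
  have e5 : ∫ z in Q k, σ * (ut z * fderiv ℝ φ z (0, 1) - ux z * fderiv ℝ φ z (1, 0)) = 0 := by
    rw [integral_const_mul, hw φ hφ hs, mul_zero]
  have e6 : ∫ z in Q k, (ut z * fderiv ℝ φ z (1, 0) - ux z * fderiv ℝ φ z (0, 1)) = 0 := by
    rw [integral_sub i1 i2, e3, sub_self]
  refine Eq.trans ?_ (e4.trans (by erw [e5, e6]; simp))
  refine integral_congr_ae (Eventually.of_forall fun z => ?_)
  simp only [fderiv_comb φ z σ, Pi.sub_apply]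
  linear_combination (- ux z * fderiv ℝ φ z (0, 1)) * hσ

/-- A function on `Q k` whose weak derivative along the lines `t + σ x = ξ` vanishes is a
function of `t + σ x`. -/
theorem IsSlicing.exists_eq_comp_char (hs : IsSlicing k σ S lo hi) {A : ℝ × ℝ → ℝ}
    (hA : MemL2loc (Q k) A)
    (hw : ∀ φ : ℝ × ℝ → ℝ, IsTestFunction φ → tsupport φ ⊆ Q k →
      ∫ z in Q k, A z * fderiv ℝ φ z (1, -σ) = 0) :
    ∃ α : ℝ → ℝ, AEStronglyMeasurable α ∧
      ∀ᵐ z ∂(volume.restrict (Q k)), A z = α (z.2 + σ * z.1) := by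
  have hm := measurableSet_Q k
  have hU := hA.locallyIntegrable_indicator hm
  obtain ⟨G, hG, hGeq⟩ := exists_conull_eq_of_weakDeriv_eq_zero hU (isOpen_Q k)
  set U := (Q k).indicator A with hUdef
  have mp := measurePreserving_shear σ
  have hU' : AEStronglyMeasurable (fun p : ℝ × ℝ => U (p.1, p.2 - σ * p.1)) :=
    hU.aestronglyMeasurable.comp_measurePreserving mp
  -- The profile is the mean of `A` over each slice. This choice makes it measurable, and the mean
  -- equals the constant value on almost every slice.
  refine ⟨fun ξ => (∫ x, U (x, ξ - σ * x)) / (hi ξ - lo ξ), ?_, ?_⟩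
  · have h1 : AEStronglyMeasurable (fun ξ => ∫ x, U (x, ξ - σ * x)) :=
      AEStronglyMeasurable.integral_prod_right' (f := fun p : ℝ × ℝ => U (p.2, p.1 - σ * p.2))
        (hU'.comp_measurePreserving Measure.measurePreserving_swap)
    exact (h1.aemeasurable.div
      (hs.measurable_hi.sub hs.measurable_lo).aemeasurable).aestronglyMeasurable
  have hGs : ∀ᵐ p : ℝ × ℝ, (p.1, p.2 - σ * p.1) ∈ G := mp.quasiMeasurePreserving.ae hG
  have hGξ : ∀ᵐ ξ : ℝ, ∀ᵐ x : ℝ, (x, ξ - σ * x) ∈ G := by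
    have : ∀ᵐ p : ℝ × ℝ, (p.2, p.1 - σ * p.2) ∈ G :=
      (Measure.measurePreserving_swap (μ := (volume : Measure ℝ))
        (ν := (volume : Measure ℝ))).quasiMeasurePreserving.ae hGs
    exact Measure.ae_ae_of_ae_prod this
  -- Transferring the Fubini statement back by the shear: for almost every `z`, almost every point
  -- of the line through `z` is good.
  have hGξ' : ∀ᵐ z : ℝ × ℝ, ∀ᵐ x : ℝ, (x, (z.2 + σ * z.1) - σ * x) ∈ G := by
    have h1 : ∀ᵐ p : ℝ × ℝ, ∀ᵐ x : ℝ, (x, p.2 - σ * x) ∈ G :=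
      Measure.quasiMeasurePreserving_snd.ae hGξ
    have h2 := (measurePreserving_shear (-σ)).quasiMeasurePreserving.ae h1
    simpa only [neg_mul, sub_neg_eq_add] using h2
  rw [ae_restrict_iff' hm]
  filter_upwards [hG, hGξ'] with z hz hξ hzQ
  set ξ := z.2 + σ * z.1 with hξdef
  have ez : (z.1, ξ - σ * z.1) = z := by ext <;> simp [hξdef]
  have hmem : ξ ∈ S ∧ lo ξ < z.1 ∧ z.1 < hi ξ := (hs.mem_iff ξ z.1).1 (by rwa [ez])
  have hlt := hs.lt ξ hmem.1
  have hval : ∀ᵐ x : ℝ, U (x, ξ - σ * x) = (Ioo (lo ξ) (hi ξ)).indicator (fun _ => A z) x := by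
    filter_upwards [hξ] with x hx
    by_cases hxm : x ∈ Ioo (lo ξ) (hi ξ)
    · have hxQ : (x, ξ - σ * x) ∈ Q k := (hs.mem_iff ξ x).2 ⟨hmem.1, hxm⟩
      rw [indicator_of_mem hxm]
      have hUz : U z = A z := indicator_of_mem hzQ _
      rw [← hUz]
      refine hGeq _ hx z hz ((convex_Q k).segment_subset hxQ hzQ) fun φ hφ hsφ => ?_
      have ev : z - (x, ξ - σ * x) = (z.1 - x) • ((1 : ℝ), -σ) := by
        ext <;> simp [hξdef]; ring
      have e1 : ∀ y, U y * fderiv ℝ φ y (z - (x, ξ - σ * x)) =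
          (z.1 - x) * (Q k).indicator (fun y => A y * fderiv ℝ φ y (1, -σ)) y := fun y => by
        rw [ev, map_smul, smul_eq_mul, hUdef]
        by_cases hy : y ∈ Q k
        · simp only [indicator_of_mem hy]; ring
        · simp only [indicator_of_notMem hy]; ring
      simp only [e1]
      rw [integral_const_mul, integral_indicator hm, hw φ hφ hsφ, mul_zero]
    · rw [indicator_of_notMem hxm]
      exact indicator_of_notMem (fun h => hxm ((hs.mem_iff ξ x).1 h).2) _
  rw [integral_congr_ae hval, integral_indicator measurableSet_Ioo, setIntegral_const]
  have hne : hi ξ - lo ξ ≠ 0 := (sub_pos.2 hlt).ne'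
  simp only [Real.volume_real_Ioo_of_le hlt.le, smul_eq_mul]
  field_simp

/-- Square integrability of a function of `t + σ x` on a rectangle in the coordinates `(x, ξ)`. -/
theorem memLp_of_eq_comp_char {A : ℝ × ℝ → ℝ} (hA : MemL2loc (Q k) A) {α : ℝ → ℝ}
    (hα : AEStronglyMeasurable α)
    (hAα : ∀ᵐ z ∂(volume.restrict (Q k)), A z = α (z.2 + σ * z.1)) {x₁ x₂ ξ₁ ξ₂ : ℝ}
    (hx : x₁ < x₂) (hsub : ∀ x ∈ Ioo x₁ x₂, ∀ ξ ∈ Ioo ξ₁ ξ₂, (x, ξ - σ * x) ∈ Q k) :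
    MemLp α 2 (volume.restrict (Ioo ξ₁ ξ₂)) := by
  set I := Ioo x₁ x₂
  set J := Ioo ξ₁ ξ₂
  set T : Set (ℝ × ℝ) := (fun p : ℝ × ℝ => (p.1, p.2 - -σ * p.1)) ⁻¹' (I ×ˢ J) with hT
  have hTQ : T ⊆ Q k := fun z hz => by
    have := hsub z.1 hz.1 _ hz.2
    simpa using this
  have hK : IsCompact ((fun p : ℝ × ℝ => (p.1, p.2 - σ * p.1)) '' (Icc x₁ x₂ ×ˢ Icc ξ₁ ξ₂)) :=
    (isCompact_Icc.prod isCompact_Icc).image (by fun_prop)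
  have hTK : T ⊆ (fun p : ℝ × ℝ => (p.1, p.2 - σ * p.1)) '' (Icc x₁ x₂ ×ˢ Icc ξ₁ ξ₂) :=
    fun z hz => ⟨(z.1, z.2 - -σ * z.1), ⟨Ioo_subset_Icc_self hz.1, Ioo_subset_Icc_self hz.2⟩, by
      ext <;> simp⟩
  have h1 : MemLp A 2 (volume.restrict T) :=
    (hA _ hK).mono_measure (Measure.restrict_mono (subset_inter hTQ hTK) le_rfl)
  have h2 : MemLp (fun z : ℝ × ℝ => α (z.2 + σ * z.1)) 2 (volume.restrict T) :=
    h1.ae_eq (ae_restrict_of_ae_restrict_of_subset hTQ hAα)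
  have mp := (measurePreserving_shear σ).restrict_preimage
    (s := T) ((measurableSet_Ioo.prod measurableSet_Ioo).preimage (by fun_prop))
  have h3 := h2.comp_measurePreserving mp
  have hpre : (fun p : ℝ × ℝ => (p.1, p.2 - σ * p.1)) ⁻¹' T = I ×ˢ J := by
    ext p; simp [hT]
  rw [hpre, Measure.volume_eq_prod, ← Measure.prod_restrict] at h3
  have h4 : MemLp (α ∘ Prod.snd) 2 ((volume.restrict I).prod (volume.restrict J)) := by
    refine h3.ae_eq (Eventually.of_forall fun p => ?_)
    simp
  have hI0 : (volume.restrict I) univ ≠ 0 := by simp [I, hx]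
  have hIt : (volume.restrict I) univ ≠ ⊤ := by simp [I]
  -- The image of the product measure under the second projection is the length of `I` times
  -- Lebesgue measure on `J`; this finite nonzero factor is then divided out.
  rw [← memLp_map_measure_iff (by
    rw [Measure.map_snd_prod]; exact (hα.restrict).smul_measure _) (by fun_prop),
    Measure.map_snd_prod] at h4
  have h5 := h4.smul_measure (c := ((volume.restrict I) univ)⁻¹) (by simpa using hI0)
  rwa [smul_smul, ENNReal.inv_mul_cancel hI0 hIt, one_smul] at h5

end Characteristics

/-! ### Local integrability on half-lines -/

section LocallyIntegrableOn

theorem LocallyIntegrableOn.integrable_mul_testFunction {I : Set ℝ}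
    {g : ℝ → ℝ} (hg : LocallyIntegrableOn g I) {θ : ℝ → ℝ} (hθ : IsTestFunction θ)
    (hs : tsupport θ ⊆ I) : Integrable (fun x => g x * θ x) := by
  have h1 : IntegrableOn (fun x => g x * θ x) (tsupport θ) :=
    (hg.integrableOn_compact_subset hs hθ.2).mul_continuousOn hθ.continuous.continuousOn hθ.2
  exact h1.integrable_of_forall_notMem_eq_zero fun x hx => by
    rw [image_eq_zero_of_notMem_tsupport hx, mul_zero]

theorem locallyIntegrableOn_of_memLp_Ioo {g : ℝ → ℝ} {b : ℝ}
    (hg : ∀ p, b < p → ∀ r, MemLp g 2 (volume.restrict (Ioo p r))) :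
    LocallyIntegrableOn g (Ioi b) := by
  intro x hx
  have hx' : b < x := hx
  refine ⟨Ioo ((b + x) / 2) (x + 1), mem_nhdsWithin_of_mem_nhds
    (Ioo_mem_nhds (by linarith) (by linarith)), ?_⟩
  exact (hg _ (by linarith) _).integrable (by norm_num)

end LocallyIntegrableOn

/-! ### Test functions concentrated near one piece of the boundary -/

section TensorTestFunctions

/-- The tensor product of two functions of one variable. -/
def tens (θ χ : ℝ → ℝ) (z : ℝ × ℝ) : ℝ := θ z.1 * χ z.2

theorem tsupport_tens_subset (θ χ : ℝ → ℝ) : tsupport (tens θ χ) ⊆ tsupport θ ×ˢ tsupport χ := by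
  refine closure_minimal (fun z hz => ?_) ((isClosed_tsupport θ).prod (isClosed_tsupport χ))
  have hz' : θ z.1 * χ z.2 ≠ 0 := hz
  exact ⟨subset_tsupport θ (left_ne_zero_of_mul hz'), subset_tsupport χ (right_ne_zero_of_mul hz')⟩

theorem isTestFunction_tens {θ χ : ℝ → ℝ} (hθ : IsTestFunction θ) (hχ : IsTestFunction χ) :
    IsTestFunction (tens θ χ) :=
  ⟨(hθ.1.comp contDiff_fst).mul (hχ.1.comp contDiff_snd),
    (hθ.2.isCompact.prod hχ.2.isCompact).of_isClosed_subset (isClosed_tsupport _)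
      (tsupport_tens_subset θ χ)⟩

/-- The radius `1 / 2` is below `1`, the least width of the domain, so a cutoff around `x = 0` does
not see the moving boundary, nor the other way round. -/
theorem exists_cutoff : ∃ χ : ℝ → ℝ, IsTestFunction χ ∧ χ 0 = 1 ∧ ∀ x, 1 / 2 < |x| → χ x = 0 := by
  let ρ : ContDiffBump (0 : ℝ) := ⟨1 / 4, 1 / 2, by norm_num, by norm_num⟩
  refine ⟨ρ, ⟨ρ.contDiff, ρ.hasCompactSupport⟩, ?_, fun x hx => ρ.zero_of_le_dist ?_⟩
  · exact ρ.one_of_mem_closedBall (Metric.mem_closedBall_self (by norm_num [ρ]))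
  · rw [dist_zero_right, Real.norm_eq_abs]; exact hx.le

/-- A test function localized near the moving boundary. -/
def movingTens (k : ℝ) (θ χ : ℝ → ℝ) (z : ℝ × ℝ) : ℝ := tens θ χ (z.2, z.1 - 1 - k * z.2)

theorem isTestFunction_movingTens (k : ℝ) {θ χ : ℝ → ℝ} (hθ : IsTestFunction θ)
    (hχ : IsTestFunction χ) : IsTestFunction (movingTens k θ χ) := by
  have ht := isTestFunction_tens hθ hχ
  refine ⟨ht.1.comp (by fun_prop), ?_⟩
  have hinv : Function.LeftInverse (fun y : ℝ × ℝ => (y.2 + 1 + k * y.1, y.1))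
      (fun z : ℝ × ℝ => (z.2, z.1 - 1 - k * z.2)) := fun z => by
    ext
    · simp only; ring
    · rfl
  exact ht.2.comp_isClosedEmbedding (hinv.isClosedEmbedding (by fun_prop) (by fun_prop))

theorem tsupport_movingTens_subset (k : ℝ) (θ χ : ℝ → ℝ) :
    tsupport (movingTens k θ χ) ⊆ {z | z.2 ∈ tsupport θ ∧ z.1 - 1 - k * z.2 ∈ tsupport χ} := by
  refine closure_minimal (fun z hz => ?_) (((isClosed_tsupport θ).preimage continuous_snd).inter
    ((isClosed_tsupport χ).preimage (by fun_prop)))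
  have hz' : θ z.2 * χ (z.1 - 1 - k * z.2) ≠ 0 := hz
  exact ⟨subset_tsupport θ (left_ne_zero_of_mul hz'), subset_tsupport χ (right_ne_zero_of_mul hz')⟩

end TensorTestFunctions

/-! ### Relations between the two characteristic profiles -/

section Identification

variable {k : ℝ}

/-- Green's formula for `ut`, `ux` given by the characteristic profiles `α`, `β`. -/
theorem integral_profiles_green (hk : 0 < k) (hk1 : k < 1) {ux ut : ℝ × ℝ → ℝ}
    (hx : MemL2loc (Q k) ux) (ht : MemL2loc (Q k) ut) {α β : ℝ → ℝ}
    (hα : ∀ᵐ z ∂(volume.restrict (Q k)), ut z + 1 * ux z = 2 * α (z.2 + 1 * z.1))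
    (hβ : ∀ᵐ z ∂(volume.restrict (Q k)), ut z + -1 * ux z = 2 * β (z.2 + -1 * z.1))
    {φ : ℝ × ℝ → ℝ} (hφ : IsTestFunction φ) :
    ∫ z in Q k, (ut z * fderiv ℝ φ z (0, 1) - ux z * fderiv ℝ φ z (1, 0)) =
      (∫ ξ in Ioi (-1 : ℝ), β ξ * (φ ((1 + k * ξ) / (1 - k), ξ - -1 * ((1 + k * ξ) / (1 - k))) -
        φ (max 0 (-ξ), ξ - -1 * max 0 (-ξ)))) -
      ∫ ξ in Ioi (0 : ℝ), α ξ * (φ (min ξ ((1 + k * ξ) / (1 + k)),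
        ξ - 1 * min ξ ((1 + k * ξ) / (1 + k))) - φ (0, ξ - 1 * 0)) := by
  have hm := measurableSet_Q k
  have i1 : IntegrableOn (fun z => α (z.2 + 1 * z.1) * fderiv ℝ φ z (1, -1)) (Q k) := by
    have := (ht.add (hx.const_mul 1)).integrableOn_mul_fderiv hm hφ (1, -1)
    refine (this.const_mul (1 / 2)).congr ?_
    filter_upwards [hα] with z hz
    rw [hz]; ring
  have i2 : IntegrableOn (fun z => β (z.2 + -1 * z.1) * fderiv ℝ φ z (1, - -1)) (Q k) := by
    have := (ht.add (hx.const_mul (-1))).integrableOn_mul_fderiv hm hφ (1, - -1)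
    refine (this.const_mul (1 / 2)).congr ?_
    filter_upwards [hβ] with z hz
    rw [hz]; ring
  rw [← (isSlicing_one hk).integral_char_mul_fderiv hφ i1,
    ← (isSlicing_neg_one hk hk1).integral_char_mul_fderiv hφ i2, ← integral_sub i2 i1]
  refine integral_congr_ae ?_
  filter_upwards [hα, hβ] with z h1 h2
  have e1 : ut z = α (z.2 + 1 * z.1) + β (z.2 + -1 * z.1) := by linarith
  have e2 : ux z = α (z.2 + 1 * z.1) - β (z.2 + -1 * z.1) := by linarith
  rw [e1, e2, fderiv_comb φ z (-1), fderiv_comb φ z 1]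
  ring

/-- The boundary identities at `t = 0` and at `x = 0` determine relations between the profiles. -/
theorem profiles_relations (hk : 0 < k) (hk1 : k < 1) {α β g u1 : ℝ → ℝ}
    (hα : LocallyIntegrableOn α (Ioi 0)) (hβ : LocallyIntegrableOn β (Ioi (-1)))
    (hu1 : MemL2loc (Ioo 0 1) u1)
    (hI : ∀ φ : ℝ × ℝ → ℝ, IsTestFunction φ →
      ((∫ ξ in Ioi (-1 : ℝ), β ξ * (φ ((1 + k * ξ) / (1 - k), ξ - -1 * ((1 + k * ξ) / (1 - k))) -
        φ (max 0 (-ξ), ξ - -1 * max 0 (-ξ)))) -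
      ∫ ξ in Ioi (0 : ℝ), α ξ * (φ (min ξ ((1 + k * ξ) / (1 + k)),
        ξ - 1 * min ξ ((1 + k * ξ) / (1 + k))) - φ (0, ξ - 1 * 0))) +
      (∫ t in Ioi (0 : ℝ), g t * φ (1 + k * t, t)) +
      (∫ x in Ioo (0 : ℝ) 1, u1 x * φ (x, 0)) = 0) :
    (∀ᵐ x ∂(volume.restrict (Ioo (0 : ℝ) 1)), u1 x - (α x + β (-x)) = 0) ∧
    ∀ᵐ t ∂(volume.restrict (Ioi (0 : ℝ))), α t - β t = 0 := by
  obtain ⟨χ, hχ, hχ0, hχs⟩ := exists_cutoff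
  have hp : 0 < 1 + k := by linarith
  have hn : 0 < 1 - k := by linarith
  have hhi {ξ : ℝ} (hξ : -1 < ξ) : 1 ≤ (1 + k * ξ) / (1 - k) := by
    rw [le_div_iff₀ hn]; nlinarith
  have hmin {ξ : ℝ} (hξ : 1 ≤ ξ) : 1 ≤ min ξ ((1 + k * ξ) / (1 + k)) :=
    le_min hξ (by rw [le_div_iff₀ hp]; nlinarith)
  have hmin' {ξ : ℝ} (hξ : ξ < 1) : min ξ ((1 + k * ξ) / (1 + k)) = ξ :=
    min_eq_left (by rw [le_div_iff₀ hp]; nlinarith)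
  have hχ1 {x : ℝ} (hx : 1 ≤ x) : χ x = 0 := hχs x (by rw [abs_of_nonneg] <;> linarith)
  constructor
  · have hαI : LocallyIntegrableOn α (Ioo 0 1) := hα.mono_set Ioo_subset_Ioi_self
    have hβI : LocallyIntegrableOn (fun x => β (-x)) (Ioo 0 1) := by
      intro x hx
      obtain ⟨s, hs, hi⟩ := hβ (-x) (by have := hx.2; simp only [mem_Ioi]; linarith)
      rw [nhdsWithin_eq_nhds.2 (Ioi_mem_nhds (by have := hx.2; linarith))] at hs
      refine ⟨Neg.neg ⁻¹' s, mem_nhdsWithin_of_mem_nhds (continuous_neg.continuousAt hs), ?_⟩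
      exact (Measure.measurePreserving_neg (volume : Measure ℝ)).integrableOn_comp_preimage
        (Homeomorph.neg ℝ).measurableEmbedding |>.2 hi
    refine ae_eq_zero_of_integral_mul_testFunction isOpen_Ioo
      ((hu1.locallyIntegrableOn measurableSet_Ioo).sub (hαI.add hβI)) fun θ hθ hs => ?_
    have hθz : ∀ x, x ∉ Ioo (0 : ℝ) 1 → θ x = 0 := fun x hx =>
      image_eq_zero_of_notMem_tsupport fun h => hx (hs h)
    have hθ1 {x : ℝ} (hx : 1 ≤ x) : θ x = 0 := hθz x fun h => by linarith [h.2]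
    have hθ0 : θ 0 = 0 := hθz 0 (by simp)
    have j1 := LocallyIntegrableOn.integrable_mul_testFunction hαI hθ hs
    have j2 := LocallyIntegrableOn.integrable_mul_testFunction hβI hθ hs
    have j3 := hu1.integrableOn_mul_testFunction measurableSet_Ioo hθ
    -- The test function `θ(x) χ(t)` vanishes at `x = 0` and for `x ≥ 1`; of the boundary terms only
    -- those on the bottom survive, where it equals `θ(x)`.
    have := hI _ (isTestFunction_tens hθ hχ)
    have a1 : ∫ ξ in Ioi (-1 : ℝ), β ξ * (tens θ χ ((1 + k * ξ) / (1 - k),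
        ξ - -1 * ((1 + k * ξ) / (1 - k))) - tens θ χ (max 0 (-ξ), ξ - -1 * max 0 (-ξ))) =
        - ∫ x in Ioo (0 : ℝ) 1, β (-x) * θ x := by
      have e := integral_Ioo_comp_neg (fun x => β (-x) * θ x) (-1) 0
      rw [neg_neg, neg_zero] at e
      rw [← e, ← integral_neg, ← inter_eq_right.2 (show Ioo (-1 : ℝ) 0 ⊆ Ioi (-1) from Ioo_subset_Ioi_self),
        ← setIntegral_indicator measurableSet_Ioo]
      refine setIntegral_congr_fun measurableSet_Ioi fun ξ hξ => ?_
      simp only [tens, hθ1 (hhi hξ)]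
      by_cases h0 : ξ < 0
      · rw [indicator_of_mem (show ξ ∈ Ioo (-1 : ℝ) 0 from ⟨hξ, h0⟩), max_eq_right (by linarith)]
        simp [hχ0]
      · rw [indicator_of_notMem (fun h => h0 h.2), max_eq_left (by linarith), hθ0]
        simp
    have a2 : ∫ ξ in Ioi (0 : ℝ), α ξ * (tens θ χ (min ξ ((1 + k * ξ) / (1 + k)),
        ξ - 1 * min ξ ((1 + k * ξ) / (1 + k))) - tens θ χ (0, ξ - 1 * 0)) =
        ∫ x in Ioo (0 : ℝ) 1, α x * θ x := by
      rw [← inter_eq_right.2 (show Ioo (0 : ℝ) 1 ⊆ Ioi 0 from Ioo_subset_Ioi_self),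
        ← setIntegral_indicator measurableSet_Ioo]
      refine setIntegral_congr_fun measurableSet_Ioi fun ξ hξ => ?_
      simp only [tens, hθ0]
      by_cases h0 : ξ < 1
      · rw [indicator_of_mem (show ξ ∈ Ioo (0 : ℝ) 1 from ⟨hξ, h0⟩), hmin' h0]
        simp [hχ0]
      · rw [indicator_of_notMem (fun h => h0 h.2), hθ1 (hmin (not_lt.1 h0))]
        simp
    have a3 : ∫ t in Ioi (0 : ℝ), g t * tens θ χ (1 + k * t, t) = 0 :=
      setIntegral_eq_zero_of_forall_eq_zero fun t ht => by
        have := mul_pos hk ht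
        rw [tens, hθ1 (by simp only; linarith)]; ring
    have a4 : ∫ x in Ioo (0 : ℝ) 1, u1 x * tens θ χ (x, 0) = ∫ x in Ioo (0 : ℝ) 1, u1 x * θ x := by
      simp only [tens, hχ0, mul_one]
    rw [a1, a2, a3, a4] at this
    have e := integral_sub j3 (j1.integrableOn.add j2.integrableOn)
    have e' := integral_add (j1.integrableOn (s := Ioo 0 1)) (j2.integrableOn (s := Ioo 0 1))
    simp only [Pi.add_apply] at e
    rw [e'] at e
    refine Eq.trans (integral_congr_ae (Eventually.of_forall fun x => ?_)) (e.trans (by linarith))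
    beta_reduce
    ring
  · have hβI : LocallyIntegrableOn β (Ioi 0) := hβ.mono_set (Ioi_subset_Ioi (by norm_num))
    refine ae_eq_zero_of_integral_mul_testFunction isOpen_Ioi (hα.sub hβI) fun θ hθ hs => ?_
    have hθz {x : ℝ} (hx : x ≤ 0) : θ x = 0 :=
      image_eq_zero_of_notMem_tsupport fun h => not_lt_of_ge hx (hs h)
    have j1 := LocallyIntegrableOn.integrable_mul_testFunction hα hθ hs
    have j2 := LocallyIntegrableOn.integrable_mul_testFunction hβI hθ hs
    -- The test function `χ(x) θ(t)` vanishes on the bottom and on the moving boundary, which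
    -- isolates the side `x = 0`.
    have := hI _ (isTestFunction_tens hχ hθ)
    have a1 : ∫ ξ in Ioi (-1 : ℝ), β ξ * (tens χ θ ((1 + k * ξ) / (1 - k),
        ξ - -1 * ((1 + k * ξ) / (1 - k))) - tens χ θ (max 0 (-ξ), ξ - -1 * max 0 (-ξ))) =
        - ∫ x in Ioi (0 : ℝ), β x * θ x := by
      rw [← integral_neg, ← inter_eq_right.2
        (Ioi_subset_Ioi (show (-1 : ℝ) ≤ 0 by norm_num)), ← setIntegral_indicator measurableSet_Ioi]
      refine setIntegral_congr_fun measurableSet_Ioi fun ξ hξ => ?_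
      simp only [tens, hχ1 (hhi hξ)]
      by_cases h0 : 0 < ξ
      · rw [indicator_of_mem (show ξ ∈ Ioi (0 : ℝ) from h0), max_eq_left (by linarith)]
        simp [hχ0]
      · rw [indicator_of_notMem (show ξ ∉ Ioi (0 : ℝ) from h0), max_eq_right (by linarith)]
        simp [hθz]
    have a2 : ∫ ξ in Ioi (0 : ℝ), α ξ * (tens χ θ (min ξ ((1 + k * ξ) / (1 + k)),
        ξ - 1 * min ξ ((1 + k * ξ) / (1 + k))) - tens χ θ (0, ξ - 1 * 0)) =
        - ∫ x in Ioi (0 : ℝ), α x * θ x := by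
      rw [← integral_neg]
      refine setIntegral_congr_fun measurableSet_Ioi fun ξ hξ => ?_
      simp only [tens, hχ0]
      by_cases h0 : ξ < 1
      · rw [hmin' h0]
        simp [hθz]
      · rw [hχ1 (hmin (not_lt.1 h0))]
        simp
    have a3 : ∫ t in Ioi (0 : ℝ), g t * tens χ θ (1 + k * t, t) = 0 :=
      setIntegral_eq_zero_of_forall_eq_zero fun t ht => by
        have := mul_pos hk ht
        rw [tens, hχ1 (by simp only; linarith)]; ring
    have a4 : ∫ x in Ioo (0 : ℝ) 1, u1 x * tens χ θ (x, 0) = 0 := by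
      simp [tens, hθz]
    rw [a1, a2, a3, a4] at this
    have e := integral_sub (j1.integrableOn (s := Ioi 0)) (j2.integrableOn (s := Ioi 0))
    refine Eq.trans (integral_congr_ae (Eventually.of_forall fun x => ?_)) (e.trans (by linarith))
    beta_reduce
    ring

end Identification

/-! ### D'Alembert representation of weak solutions -/

section Representation

variable {k : ℝ}

theorem quasiMeasurePreserving_char (σ : ℝ) :
    Measure.QuasiMeasurePreserving (fun z : ℝ × ℝ => z.2 + σ * z.1) := by
  have h := (Measure.quasiMeasurePreserving_snd (μ := (volume : Measure ℝ))
    (ν := (volume : Measure ℝ))).comp (measurePreserving_shear (-σ)).quasiMeasurePreserving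
  simpa [Function.comp_def] using h

/-- Away from the corners of `Q k`, the profiles of square integrable functions of `t + x` and of
`t - x` are square integrable. -/
theorem memLp_profile_pos (hk : 0 < k) {A : ℝ × ℝ → ℝ} (hA : MemL2loc (Q k) A) {α : ℝ → ℝ}
    (hα : AEStronglyMeasurable α)
    (hAα : ∀ᵐ z ∂(volume.restrict (Q k)), A z = α (z.2 + 1 * z.1)) {p : ℝ} (hp : 0 < p) (r : ℝ) :
    MemLp α 2 (volume.restrict (Ioo p r)) := by
  have hk' : 0 < 1 + k := by linarith
  -- For `ξ > p`, the bound `x < p` keeps `t = ξ - x` positive, and `(1 + k) x < 1 < 1 + k ξ` keeps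
  -- the point to the left of the moving boundary.
  refine memLp_of_eq_comp_char hA hα hAα (x₁ := 0) (x₂ := min p (1 / (1 + k)))
    (lt_min hp (by positivity)) fun x hx ξ hξ => ?_
  have h1 := lt_of_lt_of_le hx.2 (min_le_left _ _)
  have h2 := lt_of_lt_of_le hx.2 (min_le_right _ _)
  rw [lt_div_iff₀ hk'] at h2
  have h3 := hξ.1
  have := mul_pos hk (hp.trans h3)
  exact ⟨hx.1, by simp only; linarith, by simp only; linarith⟩

theorem memLp_profile_neg (hk : 0 < k) {A : ℝ × ℝ → ℝ} (hA : MemL2loc (Q k) A)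
    {β : ℝ → ℝ} (hβ : AEStronglyMeasurable β)
    (hAβ : ∀ᵐ z ∂(volume.restrict (Q k)), A z = β (z.2 + -1 * z.1)) {p : ℝ} (hp : -1 < p)
    (r : ℝ) : MemLp β 2 (volume.restrict (Ioo p r)) := by
  refine memLp_of_eq_comp_char hA hβ hAβ (x₁ := max 0 (-p)) (x₂ := 1)
    (max_lt one_pos (by linarith)) fun x hx ξ hξ => ?_
  have h1 := lt_of_le_of_lt (le_max_left _ _) hx.1
  have h2 := lt_of_le_of_lt (le_max_right _ _) hx.1
  have h3 := hx.2
  have h4 := hξ.1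
  exact ⟨h1, by simp only; nlinarith, by simp only; linarith⟩

/-- The derivatives of a weak solution are waves with a common square integrable profile. -/
theorem exists_derivative_profile (hk : 0 < k) (hk1 : k < 1) {u1 g : ℝ → ℝ}
    (hu1 : MemLp u1 2 (volume.restrict (Ioo (0 : ℝ) 1))) {u ux ut : ℝ × ℝ → ℝ}
    (hu : IsH1locPlane (Q k) u ux ut)
    (hw : ∀ φ : ℝ × ℝ → ℝ, IsTestFunction φ →
      (∫ z in Q k, (ut z * fderiv ℝ φ z (0, 1) - ux z * fderiv ℝ φ z (1, 0)))
        + (∫ t in Ioi (0 : ℝ), g t * φ (1 + k * t, t))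
        + (∫ x in Ioo (0 : ℝ) 1, u1 x * φ (x, 0)) = 0) :
    ∃ h : ℝ → ℝ, MemL2loc univ h ∧ (∀ᵐ z ∂(volume.restrict (Q k)), ut z = wave h z) ∧
      (∀ᵐ z ∂(volume.restrict (Q k)), ux z = waveX h z) ∧
      ∀ᵐ x ∂(volume.restrict (Ioo (0 : ℝ) 1)), u1 x = h x + h (-x) := by
  have hm := measurableSet_Q k
  have hx := hu.2.1
  have ht := hu.2.2.1
  have hu1' : MemL2loc (Ioo 0 1) u1 := fun K _ =>
    hu1.mono_measure (Measure.restrict_mono inter_subset_left le_rfl)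
  have hint : ∀ φ : ℝ × ℝ → ℝ, IsTestFunction φ → tsupport φ ⊆ Q k →
      ∫ z in Q k, (ut z * fderiv ℝ φ z (0, 1) - ux z * fderiv ℝ φ z (1, 0)) = 0 := by
    intro φ hφ hs
    have hz : ∀ z, z ∉ Q k → φ z = 0 := fun z hz =>
      image_eq_zero_of_notMem_tsupport fun h => hz (hs h)
    have := hw φ hφ
    simpa [fun t => hz (1 + k * t, t) (by simp [Q]), fun x => hz (x, 0) (by simp [Q])] using this
  have half {A : ℝ × ℝ → ℝ} {σ : ℝ} (hA : ∃ α : ℝ → ℝ, AEStronglyMeasurable α ∧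
      ∀ᵐ z ∂(volume.restrict (Q k)), A z = α (z.2 + σ * z.1)) :
      ∃ α : ℝ → ℝ, AEStronglyMeasurable α ∧
        ∀ᵐ z ∂(volume.restrict (Q k)), A z = 2 * α (z.2 + σ * z.1) := by
    obtain ⟨α, h1, h2⟩ := hA
    refine ⟨fun s => 1 / 2 * α s, h1.const_mul _, ?_⟩
    filter_upwards [h2] with z hz
    rw [hz]; ring
  obtain ⟨α, hαm, hα⟩ := half ((isSlicing_one hk).exists_eq_comp_char (ht.add (hx.const_mul 1))
    fun φ hφ hs => integral_char_comb_eq_zero hu hint (by norm_num) hφ hs)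
  obtain ⟨β, hβm, hβ⟩ := half ((isSlicing_neg_one hk hk1).exists_eq_comp_char
    (ht.add (hx.const_mul (-1)))
    fun φ hφ hs => integral_char_comb_eq_zero hu hint (by norm_num) hφ hs)
  have half' {A : ℝ × ℝ → ℝ} {γ : ℝ → ℝ} {σ : ℝ}
      (h : ∀ᵐ z ∂(volume.restrict (Q k)), A z = 2 * γ (z.2 + σ * z.1)) :
      ∀ᵐ z ∂(volume.restrict (Q k)), 1 / 2 * A z = γ (z.2 + σ * z.1) := by
    filter_upwards [h] with z hz
    rw [hz]; ring
  have hαL {p : ℝ} (hp : 0 < p) (r : ℝ) := memLp_profile_pos hk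
    ((ht.add (hx.const_mul 1)).const_mul (1 / 2)) hαm (half' hα) hp r
  have hβL {p : ℝ} (hp : -1 < p) (r : ℝ) := memLp_profile_neg hk
    ((ht.add (hx.const_mul (-1))).const_mul (1 / 2)) hβm (half' hβ) hp r
  obtain ⟨hr1, hr2⟩ := profiles_relations (g := g) hk hk1
    (locallyIntegrableOn_of_memLp_Ioo fun p hp r => hαL hp r)
    (locallyIntegrableOn_of_memLp_Ioo fun p hp r => hβL hp r) hu1' fun φ hφ => by
      rw [← integral_profiles_green hk hk1 hx ht hα hβ hφ]
      exact hw φ hφ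
  -- Slices shrink to a point for `α` near `0` and for `β` near `-1`, so square integrability there
  -- cannot come from `ut`, `ux`. It is recovered in a chain: `β` is square integrable near `0`,
  -- hence so is `α = β` on `(0, 1)`, and then `β(-x) = u1(x) - α(x)` covers `(-1, 0)`.
  have hβ0 (r : ℝ) : MemLp β 2 (volume.restrict (Ioo 0 r)) :=
    (hβL (p := -1 / 2) (by norm_num) r).mono_measure
      (Measure.restrict_mono (Ioo_subset_Ioo (by norm_num) le_rfl) le_rfl)
  have hr2' : ∀ᵐ x ∂(volume.restrict (Ioo (0 : ℝ) 1)), β x = α x := by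
    filter_upwards [ae_restrict_of_ae_restrict_of_subset Ioo_subset_Ioi_self hr2] with x hx
    linarith
  have hβn : MemLp (fun x => β (-x)) 2 (volume.restrict (Ioo 0 1)) := by
    refine (hu1.sub ((hβ0 1).ae_eq hr2')).ae_eq ?_
    filter_upwards [hr1] with x hx
    simp only [Pi.sub_apply]
    linarith
  have hβn' : MemLp β 2 (volume.restrict (Ioo (-1) 0)) := by
    have mp := (Measure.measurePreserving_neg (volume : Measure ℝ)).restrict_preimage
      (s := Ioo (0 : ℝ) 1) measurableSet_Ioo
    have h1 := hβn.comp_measurePreserving mp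
    have h2 : Neg.neg ⁻¹' Ioo (0 : ℝ) 1 = Ioo (-1) 0 := by ext x; simp [and_comm, neg_lt]
    rw [h2] at h1
    simpa [Function.comp_def] using h1
  have hh : MemL2loc univ ((Ioi (-1)).indicator β) := by
    rw [memL2loc_univ]
    intro K hK
    obtain ⟨R, hR⟩ := hK.isBounded.subset_ball 0
    have h1 := (memLp_indicator_iff_restrict measurableSet_Ioo).2 hβn'
    have h2 : MemLp ((Ico 0 R).indicator β) 2 := by
      refine (memLp_indicator_iff_restrict measurableSet_Ico).2 ?_
      have hsub : Ico 0 R ⊆ Ioo (-1 / 2) R := fun x hx => ⟨by linarith [hx.1], hx.2⟩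
      exact (hβL (p := -1 / 2) (by norm_num) R).mono_measure
        (Measure.restrict_mono hsub le_rfl)
    refine ((h1.add h2).restrict K).ae_eq ?_
    filter_upwards [ae_restrict_mem hK.measurableSet] with x hx
    have hxR : x < R := by
      have := hR hx
      rw [Real.ball_eq_Ioo] at this
      linarith [this.2]
    simp only [Pi.add_apply, indicator, mem_Ioo, mem_Ico, mem_Ioi]
    split_ifs <;> simp_all <;> linarith
  have hpos : ∀ᵐ z ∂(volume.restrict (Q k)), α (z.2 + 1 * z.1) = β (z.2 + 1 * z.1) := by
    rw [ae_restrict_iff' measurableSet_Ioi] at hr2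
    rw [ae_restrict_iff' hm]
    filter_upwards [(quasiMeasurePreserving_char 1).ae hr2] with z hz hzQ
    have := hz (by have := hzQ.1; have := hzQ.2.2; simp only [mem_Ioi]; linarith)
    linarith
  have hval : ∀ᵐ z ∂(volume.restrict (Q k)),
      ut z = wave ((Ioi (-1)).indicator β) z ∧ ux z = waveX ((Ioi (-1)).indicator β) z := by
    filter_upwards [hα, hβ, hpos, ae_restrict_mem hm] with z h1 h2 h3 hzQ
    obtain ⟨q1, q2, q3⟩ := hzQ
    have m1 : z.2 + z.1 ∈ Ioi (-1 : ℝ) := by simp only [mem_Ioi]; linarith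
    have m2 : z.2 - z.1 ∈ Ioi (-1 : ℝ) := by simp only [mem_Ioi]; nlinarith
    rw [h3] at h1
    simp only [one_mul, neg_one_mul, ← sub_eq_add_neg] at h1 h2
    rw [wave, waveX, indicator_of_mem m1, indicator_of_mem m2]
    constructor <;> linarith
  refine ⟨_, hh, hval.mono fun z hz => hz.1, hval.mono fun z hz => hz.2, ?_⟩
  filter_upwards [hr1, hr2', ae_restrict_mem measurableSet_Ioo] with x h1 h2 hx
  rw [indicator_of_mem (show x ∈ Ioi (-1 : ℝ) by have := hx.1; simp only [mem_Ioi]; linarith),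
    indicator_of_mem (show -x ∈ Ioi (-1 : ℝ) by have := hx.2; simp only [mem_Ioi]; linarith)]
  linarith

theorem prim_add_const (c d : ℝ) (h : ℝ → ℝ) (s : ℝ) : prim (c + d) h s = prim c h s + d := by
  rw [prim, prim]; ring

/-- The solution and the wave of a primitive of `h` have the same weak gradient on the convex set `Q
k`, so they differ by a constant, which is absorbed into the primitive. -/
theorem exists_wave_of_derivative_profile (hk : 0 < k) (hk1 : k < 1) {u ux ut : ℝ × ℝ → ℝ}
    (hu : IsH1locPlane (Q k) u ux ut) {h : ℝ → ℝ} (hh : MemL2loc univ h)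
    (ht : ∀ᵐ z ∂(volume.restrict (Q k)), ut z = wave h z)
    (hx : ∀ᵐ z ∂(volume.restrict (Q k)), ux z = waveX h z) :
    ∃ c, ∀ᵐ z ∂(volume.restrict (Q k)), u z = wave (prim c h) z := by
  have hm := measurableSet_Q k
  have hv := isH1locPlane_wave hk hk1 hh 0
  obtain ⟨c, hc⟩ := ae_eq_const_of_weakDeriv_eq_zero (U := fun z => u z - wave (prim 0 h) z)
    (isOpen_Q k) (convex_Q k) ((hu.1.sub hv.1).locallyIntegrable_indicator hm) (by
      intro v φ hφ hs
      have e0 : ∀ y, fderiv ℝ φ y v = v.1 * fderiv ℝ φ y (1, 0) + v.2 * fderiv ℝ φ y (0, 1) :=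
        fun y => by
          rw [← smul_eq_mul, ← smul_eq_mul, ← map_smul, ← map_smul, ← map_add]
          congr 1
          ext <;> simp
      have key {w : ℝ × ℝ} {g₁ g₂ : ℝ × ℝ → ℝ} (h₁ : HasWeakDeriv (Q k) w u g₁)
          (h₂ : HasWeakDeriv (Q k) w (wave (prim 0 h)) g₂)
          (hg : ∀ᵐ z ∂(volume.restrict (Q k)), g₁ z = g₂ z) :
          ∫ z in Q k, (u z - wave (prim 0 h) z) * fderiv ℝ φ z w = 0 := by
        simp only [sub_mul]
        rw [integral_sub (hu.1.integrableOn_mul_fderiv hm hφ w)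
          (hv.1.integrableOn_mul_fderiv hm hφ w), h₁ φ hφ hs, h₂ φ hφ hs, sub_eq_zero, neg_inj]
        refine integral_congr_ae ?_
        filter_upwards [hg] with z hz
        rw [hz]
      have k1 := key hu.2.2.2.1 hv.2.2.2.1 hx
      have k2 := key hu.2.2.2.2 hv.2.2.2.2 ht
      have i1 := ((hu.1.sub hv.1).integrableOn_mul_fderiv hm hφ (1, 0)).const_mul v.1
      have i2 := ((hu.1.sub hv.1).integrableOn_mul_fderiv hm hφ (0, 1)).const_mul v.2
      have e1 := integral_add i1 i2
      rw [integral_const_mul, integral_const_mul, k1, k2, mul_zero, mul_zero, add_zero] at e1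
      refine Eq.trans ?_ e1
      refine integral_congr_ae (Eventually.of_forall fun y => ?_)
      simp only [e0]
      ring)
  -- A wave adds two values of its profile, so a constant added to the profile is counted twice.
  refine ⟨c / 2, ?_⟩
  filter_upwards [hc] with z hz
  have e := prim_add_const 0 (c / 2) h
  rw [zero_add] at e
  simp only [wave, e] at hz ⊢
  linarith

/-- D'Alembert's representation of weak solutions. -/
theorem IsWeakSolution.exists_profile (hk : 0 < k) (hk1 : k < 1) {a : ℝ} {u0 u1 : ℝ → ℝ}
    (hu0 : MemL2loc (Ioo 0 1) u0) (hu1 : MemLp u1 2 (volume.restrict (Ioo (0 : ℝ) 1)))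
    {u : ℝ × ℝ → ℝ} (hu : IsWeakSolution k a u0 u1 u) :
    ∃ (c : ℝ) (h : ℝ → ℝ), MemL2loc univ h ∧
      (∀ᵐ z ∂(volume.restrict (Q k)), u z = wave (prim c h) z) ∧
      (∀ᵐ x ∂(volume.restrict (Ioo (0 : ℝ) 1)), u0 x = prim c h x + prim c h (-x)) ∧
      (∀ᵐ x ∂(volume.restrict (Ioo (0 : ℝ) 1)), u1 x = h x + h (-x)) ∧
      ∀ᵐ s ∂(volume.restrict (Ioi (-1 : ℝ))), (1 + a) * h (F k s) = (1 - a) * h s := by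
  obtain ⟨ux, ut, w, p, q, hH, hp, hq, hinit, hmov, hw, hpq, hgreen⟩ := hu
  have hm := measurableSet_Q k
  have hn : 0 < 1 - k := by linarith
  have hk' : 0 < 1 + k := by linarith
  obtain ⟨h, hh, ht, hx, h1⟩ := exists_derivative_profile (g := fun t => q t + k * p t)
    hk hk1 hu1 hH hgreen
  obtain ⟨c, hc⟩ := exists_wave_of_derivative_profile hk hk1 hH hh ht hx
  obtain ⟨χ, hχ, hχ0, hχs⟩ := exists_cutoff
  refine ⟨c, h, hh, hc, ?_, h1, ?_⟩
  · refine ae_eq_of_integral_mul_testFunction isOpen_Ioo hu0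
      ((memL2loc_of_continuous (Ω := univ) ((continuous_prim c hh).add
        ((continuous_prim c hh).comp continuous_neg))).mono (subset_univ _)) fun θ hθ hs => ?_
    have hθz : ∀ x, x ∉ Ioo (0 : ℝ) 1 → θ x = 0 := fun x hx =>
      image_eq_zero_of_notMem_tsupport fun h => hx (hs h)
    have hφ := isTestFunction_tens hθ hχ
    have e1 := hinit _ hφ fun z hz => hs (tsupport_tens_subset θ χ hz).1
    have e2 := integral_wave_mul hk hk1 hh c hφ (fun t => by simp [tens, hθz 0 (by simp)])
      fun x t hx _ => by rw [tens, hθz x fun h => not_lt_of_ge hx h.2, zero_mul]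
    have e3 : ∫ z in Q k, (ut z * tens θ χ z + u z * fderiv ℝ (tens θ χ) z (0, 1)) =
        ∫ z in Q k, (wave h z * tens θ χ z +
          wave (prim c h) z * fderiv ℝ (tens θ χ) z (0, 1)) := by
      refine integral_congr_ae ?_
      filter_upwards [ht, hc] with z h1 h2
      rw [h1, h2]
    rw [e1, e2, neg_inj] at e3
    simpa [tens, hχ0, wave] using e3
  -- The closed support is needed here: on the support of `movingTens` it gives `x ≥ 1 / 2 + k t >
  -- 0`, as the trace condition requires.
  have hχt : tsupport χ ⊆ Icc (-(1 / 2)) (1 / 2) := by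
    refine closure_minimal (fun x hx => ?_) isClosed_Icc
    rw [mem_Icc, ← abs_le]
    by_contra hcon
    exact hx (hχs x (not_le.1 hcon))
  have hwt : ∀ᵐ t ∂(volume.restrict (Ioi (0 : ℝ))), w t = wave (prim c h) (1 + k * t, t) := by
    refine ae_eq_of_integral_mul_testFunction isOpen_Ioi hw.1
      (memL2loc_of_continuous (by
        have := continuous_prim c hh
        unfold wave; fun_prop)) fun θ hθ hs => ?_
    have hφ := isTestFunction_movingTens k hθ hχ
    have hsupp : tsupport (movingTens k θ χ) ⊆ {z | 0 < z.1 ∧ 0 < z.2} := fun z hz => by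
      obtain ⟨hz1, hz2⟩ := tsupport_movingTens_subset k θ χ hz
      have h1 : 0 < z.2 := hs hz1
      have h2 := (hχt hz2).1
      have := mul_pos hk h1
      exact ⟨by linarith, h1⟩
    have e1 := hmov _ hφ hsupp
    have e2 := integral_waveX_mul hk hh c hφ fun t =>
      image_eq_zero_of_notMem_tsupport fun h => lt_irrefl _ (hsupp h).1
    have e3 : ∫ z in Q k, (ux z * movingTens k θ χ z +
          u z * fderiv ℝ (movingTens k θ χ) z (1, 0)) =
        ∫ z in Q k, (waveX h z * movingTens k θ χ z +
          wave (prim c h) z * fderiv ℝ (movingTens k θ χ) z (1, 0)) := by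
      refine integral_congr_ae ?_
      filter_upwards [hx, hc] with z h1 h2
      rw [h1, h2]
    rw [e1, e2] at e3
    simpa [movingTens, tens, hχ0] using e3
  obtain ⟨hd, d, hwd⟩ := exists_wave_moving_eq_prim hh c k
  simp only [hwd] at hwt
  have hsum := HasWeakDeriv.ae_unique isOpen_Ioi hw.2.1 (hd.mono (subset_univ _)) hwt hw.2.2
    (hasWeakDeriv_prim d hd _)
  have hP := (hh.comp_affine 1 hk'.ne').mono (subset_univ (Ioi 0))
  have hM := (hh.comp_affine (-1) hn.ne').mono (subset_univ (Ioi 0))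
  have hflux : ∀ᵐ t ∂(volume.restrict (Ioi (0 : ℝ))), q t + k * p t =
      (1 + k) * h (1 + (1 + k) * t) - (1 - k) * h (-1 + (1 - k) * t) := by
    refine ae_eq_of_integral_mul_testFunction isOpen_Ioi (hq.add (hp.const_mul k))
      ((hP.const_mul _).sub (hM.const_mul _)) fun θ hθ hs => ?_
    have hθ0 : θ 0 = 0 := image_eq_zero_of_notMem_tsupport fun h => lt_irrefl (0 : ℝ) (hs h)
    have hφ := isTestFunction_movingTens k hθ hχ
    have e1 := hgreen _ hφ
    have e2 := integral_wave_green hk hk1 hh hφ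
    have e3 : ∫ z in Q k, (ut z * fderiv ℝ (movingTens k θ χ) z (0, 1) -
          ux z * fderiv ℝ (movingTens k θ χ) z (1, 0)) =
        ∫ z in Q k, (wave h z * fderiv ℝ (movingTens k θ χ) z (0, 1) -
          waveX h z * fderiv ℝ (movingTens k θ χ) z (1, 0)) := by
      refine integral_congr_ae ?_
      filter_upwards [ht, hx] with z h1 h2
      rw [h1, h2]
    rw [e3] at e1
    simp only [movingTens, tens, hθ0, zero_mul, mul_zero, integral_zero, add_zero,
      add_sub_cancel_left, sub_self, hχ0, mul_one] at e1 e2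
    linarith
  have hfun : ∀ᵐ t ∂(volume.restrict (Ioi (0 : ℝ))),
      (1 + a) * h (1 + (1 + k) * t) = (1 - a) * h (-1 + (1 - k) * t) := by
    filter_upwards [hsum, hflux, hpq] with t h1 h2 h3
    -- The quantities `kq + p` and `q + kp` form a linear system in `p` and `q` whose determinant is
    -- nonzero since `k² ≠ 1`.
    have hk2 : (1 - k) * (1 + k) ≠ 0 := (mul_pos hn hk').ne'
    have ep : p t = h (1 + (1 + k) * t) + h (-1 + (1 - k) * t) :=
      mul_left_cancel₀ hk2 (by linear_combination h1 - k * h2)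
    have eq : q t = h (1 + (1 + k) * t) - h (-1 + (1 - k) * t) := by
      linear_combination h2 - k * ep
    rw [ep, eq] at h3
    linear_combination h3
  have hn' : (1 / (1 - k)) ≠ 0 := by positivity
  rw [ae_restrict_iff' measurableSet_Ioi] at hfun ⊢
  -- The substitution `t = (1 + s) / (1 - k)` solves `s = t - l(t)`.
  filter_upwards [(quasiMeasurePreserving_affine (1 / (1 - k)) hn').ae hfun] with s hs hs1
  have hs1' : -1 < s := hs1
  have e0 : 1 / (1 - k) + 1 / (1 - k) * s = (1 + s) / (1 - k) := by ring
  rw [e0] at hs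
  have := hs (div_pos (by linarith) hn)
  have e1 : 1 + (1 + k) * ((1 + s) / (1 - k)) = F k s := by rw [F]; field_simp; ring
  have e2 : -1 + (1 - k) * ((1 + s) / (1 - k)) = s := by field_simp; ring
  rwa [e1, e2] at this

end Representation

/-! ### Iterating `F` and extending a profile -/

section Extension

variable {k : ℝ}

/-- The `n`-th iterate of the inverse of `F k`. -/
def backIter (k : ℝ) (n : ℕ) (s : ℝ) : ℝ := ((1 - k) / (1 + k)) ^ n * (s + 1 / k) - 1 / k

theorem backIter_zero (s : ℝ) : backIter k 0 s = s := by simp [backIter]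

theorem backIter_succ_F (hk : 0 < k) (hk1 : k < 1) (n : ℕ) (s : ℝ) :
    backIter k (n + 1) (F k s) = backIter k n s := by
  have hn : 1 - k ≠ 0 := by linarith
  have hp : 1 + k ≠ 0 := by linarith
  have h : (1 - k) / (1 + k) * (F k s + 1 / k) = s + 1 / k := by
    rw [F]; field_simp; ring
  rw [backIter, backIter, pow_succ, mul_assoc, h]

theorem backIter_le (hk : 0 < k) (hk1 : k < 1) {n : ℕ} (hn : n ≠ 0) {s : ℝ} (h1 : -1 < s)
    (h2 : s < 1) : backIter k n s ≤ -1 := by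
  have hn1 : 0 < 1 - k := by linarith
  have hp : 0 < 1 + k := by linarith
  have hr0 : 0 ≤ (1 - k) / (1 + k) := by positivity
  have hr1 : (1 - k) / (1 + k) ≤ 1 := by rw [div_le_one hp]; linarith
  have hk' : 1 < 1 / k := by rw [lt_div_iff₀ hk]; linarith
  have h3 := pow_le_of_le_one hr0 hr1 hn
  have h4 : (1 - k) / (1 + k) * (1 + 1 / k) = 1 / k - 1 := by field_simp; ring
  have h5 : ((1 - k) / (1 + k)) ^ n * (s + 1 / k) ≤ (1 - k) / (1 + k) * (1 + 1 / k) :=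
    mul_le_mul h3 (by linarith) (by linarith) hr0
  rw [backIter]
  linarith

/-- The inverse of `F` contracts with ratio `(1 - k) / (1 + k)` towards its fixed point `-1/k`,
which lies strictly below `-1`. -/
theorem exists_backIter_le (hk : 0 < k) (hk1 : k < 1) (R : ℝ) :
    ∃ N, ∀ n, N ≤ n → ∀ s ≤ R, backIter k n s ≤ -1 := by
  have hn1 : 0 < 1 - k := by linarith
  have hp : 0 < 1 + k := by linarith
  have hr0 : 0 ≤ (1 - k) / (1 + k) := by positivity
  have hr1 : (1 - k) / (1 + k) < 1 := by rw [div_lt_one hp]; linarith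
  have hk' : 1 < 1 / k := by rw [lt_div_iff₀ hk]; linarith
  have h1 := (tendsto_pow_atTop_nhds_zero_of_lt_one hr0 hr1).mul_const (R + 1 / k)
  rw [zero_mul] at h1
  obtain ⟨N, hN⟩ := eventually_atTop.1 (h1.eventually_lt_const (sub_pos.2 hk'))
  refine ⟨N, fun n hn s hs => ?_⟩
  have h2 := hN n hn
  have h3 : ((1 - k) / (1 + k)) ^ n * (s + 1 / k) ≤ ((1 - k) / (1 + k)) ^ n * (R + 1 / k) := by
    gcongr
  rw [backIter]
  linarith

/-- Extension of a profile from `(-1, 1)` by the functional equation `h ∘ F = κ h`. -/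
theorem exists_profile_extension (hk : 0 < k) (hk1 : k < 1) (κ : ℝ) {h₀ : ℝ → ℝ}
    (hh₀ : MemL2loc univ h₀) (hs₀ : ∀ s, s ∉ Ioo (-1 : ℝ) 1 → h₀ s = 0) :
    ∃ h : ℝ → ℝ, MemL2loc univ h ∧ (∀ s ∈ Ioo (-1 : ℝ) 1, h s = h₀ s) ∧
      ∀ s, -1 < s → h (F k s) = κ * h s := by
  have hz {s : ℝ} (hs : s ≤ -1) : h₀ s = 0 := hs₀ s fun h => not_lt_of_ge hs h.1
  have hsum (s : ℝ) : Summable fun n => κ ^ n * h₀ (backIter k n s) := by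
    obtain ⟨N, hN⟩ := exists_backIter_le hk hk1 s
    refine summable_of_ne_finset_zero (s := Finset.range N) fun n hn => ?_
    rw [hz (hN n (by simpa using hn) s le_rfl), mul_zero]
  -- The sum is locally finite because `h₀` vanishes at and below `-1`. Replacing `s` by `F s`
  -- shifts the index by one, and the new term `n = 0` vanishes since `F s ≥ 1`.
  refine ⟨fun s => ∑' n, κ ^ n * h₀ (backIter k n s), ?_, fun s hs => ?_, fun s hs => ?_⟩
  · rw [memL2loc_univ]
    intro K hK
    obtain ⟨R, hR⟩ := hK.isBounded.subset_closedBall 0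
    obtain ⟨N, hN⟩ := exists_backIter_le hk hk1 R
    have hr : (1 - k) / (1 + k) ≠ 0 := (div_pos (by linarith) (by linarith)).ne'
    have h1 : MemLp (fun s => ∑ n ∈ Finset.range N, κ ^ n * h₀ (backIter k n s)) 2
        (volume.restrict K) := by
      refine memLp_finsetSum _ fun n _ => MemLp.const_mul ?_ _
      have := memL2loc_univ.1 (hh₀.comp_affine (((1 - k) / (1 + k)) ^ n * (1 / k) - 1 / k)
        (pow_ne_zero n hr)) K hK
      refine this.ae_eq (Eventually.of_forall fun s => ?_)
      simp only [backIter]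
      congr 1
      ring
    refine h1.ae_eq ?_
    filter_upwards [ae_restrict_mem hK.measurableSet] with s hs
    have hsR : s ≤ R := by
      have := hR hs
      rw [Real.closedBall_eq_Icc] at this
      linarith [this.2]
    refine (tsum_eq_sum fun n hn => ?_).symm
    rw [hz (hN n (by simpa using hn) s hsR), mul_zero]
  · have h1 : ∀ n, n ≠ 0 → κ ^ n * h₀ (backIter k n s) = 0 := fun n hn => by
      rw [hz (backIter_le hk hk1 hn hs.1 hs.2), mul_zero]
    simp only
    rw [tsum_eq_single 0 h1, backIter_zero, pow_zero, one_mul]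
  · have hF : 1 ≤ F k s := by
      rw [F, le_div_iff₀ (by linarith)]; nlinarith
    simp only
    rw [(hsum (F k s)).tsum_eq_zero_add, backIter_zero, hs₀ _ fun h => not_lt_of_ge hF h.2,
      mul_zero, zero_add, ← tsum_mul_left]
    refine tsum_congr fun n => ?_
    rw [backIter_succ_F hk hk1, pow_succ]
    ring

end Extension

/-! ### Existence of weak solutions -/

section Existence

theorem prim_sub_prim_neg (c : ℝ) {h : ℝ → ℝ} (hh : MemL2loc univ h) (x : ℝ) :
    prim c h x - prim c h (-x) = ∫ y in (0 : ℝ)..x, (h y + h (-y)) := by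
  have hn : IntervalIntegrable (fun y => h (-y)) volume 0 x := by
    have := (hh.comp_affine 0 (m := -1) (by norm_num)).intervalIntegrable 0 x
    simpa using this
  rw [intervalIntegral.integral_add (hh.intervalIntegrable _ _) hn,
    intervalIntegral.integral_comp_neg, neg_zero, intervalIntegral.integral_symm 0 (-x), prim, prim]
  ring

theorem prim_add_prim_neg (c : ℝ) {h : ℝ → ℝ} (hh : MemL2loc univ h) (x : ℝ) :
    prim c h x + prim c h (-x) = 2 * c + ∫ y in (0 : ℝ)..x, (h y - h (-y)) := by
  have hn : IntervalIntegrable (fun y => h (-y)) volume 0 x := by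
    have := (hh.comp_affine 0 (m := -1) (by norm_num)).intervalIntegrable 0 x
    simpa using this
  rw [intervalIntegral.integral_sub (hh.intervalIntegrable _ _) hn,
    intervalIntegral.integral_comp_neg, neg_zero, intervalIntegral.integral_symm 0 (-x), prim, prim]
  ring

theorem memL2loc_of_memLp {I : Set ℝ} {g : ℝ → ℝ} (hg : MemLp g 2 (volume.restrict I)) :
    MemL2loc I g := fun _ _ =>
  hg.mono_measure (Measure.restrict_mono inter_subset_left le_rfl)

theorem exists_isWeakSolution {k a : ℝ} (hk : 0 < k) (hk1 : k < 1) (ha : a ≠ -1) {u0 u1 : ℝ → ℝ}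
    (hu0 : MemH1 (Ioo 0 1) u0) (hu1 : MemLp u1 2 (volume.restrict (Ioo (0 : ℝ) 1))) :
    ∃ u, IsWeakSolution k a u0 u1 u := by
  obtain ⟨hu0L, g, hg, hd⟩ := hu0
  have hg' := memL2loc_of_memLp hg
  have hu1' := memL2loc_of_memLp hu1
  obtain ⟨c, hc⟩ := hd.ae_eq_prim isOpen_Ioo (convex_Ioo 0 1) (memL2loc_of_memLp hu0L) hg'
  -- With `g` the derivative of `u0`, differentiating d'Alembert's formulas for `f(x)` and `f(-x)`
  -- gives `f'(x) = (u1 + g)/2`, called `e₁`, and `f'(-x) = (u1 - g)/2`, called `e₂`.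
  set e₁ : ℝ → ℝ := (Ioo (0 : ℝ) 1).indicator fun x => 1 / 2 * (u1 x + g x)
  set e₂ : ℝ → ℝ := (Ioo (0 : ℝ) 1).indicator fun x => 1 / 2 * (u1 x - g x)
  have he₁ : MemL2loc univ e₁ :=
    (memL2loc_iff_indicator measurableSet_Ioo).1 ((hu1'.add hg').const_mul _)
  have he₂ : MemL2loc univ e₂ :=
    (memL2loc_iff_indicator measurableSet_Ioo).1 ((hu1'.sub hg').const_mul _)
  have hz₁ {x : ℝ} (hx : x ∉ Ioo (0 : ℝ) 1) : e₁ x = 0 := indicator_of_notMem hx _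
  have hz₂ {x : ℝ} (hx : x ∉ Ioo (0 : ℝ) 1) : e₂ x = 0 := indicator_of_notMem hx _
  have he₂' : MemL2loc univ fun x => e₂ (-x) := by
    simpa using he₂.comp_affine 0 (m := -1) (by norm_num)
  obtain ⟨h, hh, hh₀, hF⟩ := exists_profile_extension hk hk1 ((1 - a) / (1 + a))
    (he₁.add he₂') fun s hs => by
      rw [hz₁ fun h => hs ⟨by linarith [h.1], h.2⟩,
        hz₂ fun h => hs ⟨by linarith [h.2], by linarith [h.1]⟩, add_zero]
  have hv {x : ℝ} (hx : x ∈ Ioo (0 : ℝ) 1) : h x = e₁ x ∧ h (-x) = e₂ x := by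
    obtain ⟨h1, h2⟩ := hx
    rw [hh₀ x ⟨by linarith, h2⟩, hh₀ (-x) ⟨by linarith, by linarith⟩,
      hz₂ (x := -x) fun h => by linarith [h.1], hz₁ (x := -x) fun h => by linarith [h.1], neg_neg]
    simp
  have ha' : 1 + a ≠ 0 := fun h => ha (by linarith)
  -- The value `f(0) = c / 2` is forced by `2 f(0) = u0(0) = c`.
  refine ⟨_, isWeakSolution_wave hk hk1 hh (c / 2) ?_ ?_ ?_⟩
  · filter_upwards [ae_restrict_mem measurableSet_Ioi] with s hs
    rw [hF s hs]
    field_simp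
  · filter_upwards [hc, ae_restrict_mem measurableSet_Ioo] with x hx hxm
    rw [hx, prim_add_prim_neg _ hh, prim, mul_div_cancel₀ c (two_ne_zero' ℝ)]
    congr 1
    refine intervalIntegral.integral_congr_ae (Eventually.of_forall fun y hy => ?_)
    rw [uIoc_of_le hxm.1.le] at hy
    have hy' : y ∈ Ioo (0 : ℝ) 1 := ⟨hy.1, hy.2.trans_lt hxm.2⟩
    rw [(hv hy').1, (hv hy').2]
    simp only [e₁, e₂, indicator_of_mem hy']
    ring
  · filter_upwards [ae_restrict_mem measurableSet_Ioo] with x hxm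
    rw [(hv hxm).1, (hv hxm).2]
    simp only [e₁, e₂, indicator_of_mem hxm]
    ring

theorem prim_zero (c s : ℝ) : prim c (fun _ => 0) s = c := by simp [prim]

theorem exists_isWeakSolution_of_trivial {k : ℝ} (hk : 0 < k) (hk1 : k < 1) (a : ℝ)
    {u0 u1 : ℝ → ℝ} (hu0 : ∃ c : ℝ, ∀ᵐ x ∂(volume.restrict (Ioo (0 : ℝ) 1)), u0 x = c)
    (hu1 : ∀ᵐ x ∂(volume.restrict (Ioo (0 : ℝ) 1)), u1 x = 0) :
    ∃ u, IsWeakSolution k a u0 u1 u := by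
  obtain ⟨c, hc⟩ := hu0
  refine ⟨_, isWeakSolution_wave hk hk1 (memL2loc_of_continuous (u := fun _ => 0) continuous_const)
    (c / 2) ?_ ?_ ?_⟩
  · simp
  · filter_upwards [hc] with x hx
    rw [hx, prim_zero, prim_zero, add_halves]
  · simpa using hu1

end Existence

/-! ### Uniqueness and the degenerate case -/

section Uniqueness

theorem ae_comp_neg_Ioo {P : ℝ → Prop} {a b : ℝ} (h : ∀ᵐ x ∂(volume.restrict (Ioo a b)), P x) :
    ∀ᵐ x ∂(volume.restrict (Ioo (-b) (-a))), P (-x) := by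
  rw [ae_restrict_iff' measurableSet_Ioo] at h ⊢
  filter_upwards [(Measure.measurePreserving_neg (volume : Measure ℝ)).quasiMeasurePreserving.ae h]
    with x hx hxm
  exact hx ⟨by linarith [hxm.2], by linarith [hxm.1]⟩

theorem prim_eq_of_ae_eq_zero {c : ℝ} {h : ℝ → ℝ}
    (hz : ∀ᵐ s ∂(volume.restrict (Ioi (-1 : ℝ))), h s = 0) {s : ℝ} (hs : -1 < s) :
    prim c h s = c := by
  rw [prim, intervalIntegral.integral_congr_ae (g := fun _ => 0)]
  · simp
  · rw [ae_restrict_iff' measurableSet_Ioi] at hz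
    filter_upwards [hz] with y hy hym
    refine hy ?_
    have h1 : min 0 s < y := hym.1
    exact lt_of_le_of_lt (le_min (by norm_num) hs.le) h1

/-- Integrating the velocity relation gives `f(x) - f(-x)`, while `u0` gives `f(x) + f(-x)`. -/
theorem eq_half_data {c : ℝ} {h u0 u1 : ℝ → ℝ} (hh : MemL2loc univ h)
    (h0 : ∀ᵐ x ∂(volume.restrict (Ioo (0 : ℝ) 1)), u0 x = prim c h x + prim c h (-x))
    (h1 : ∀ᵐ x ∂(volume.restrict (Ioo (0 : ℝ) 1)), u1 x = h x + h (-x)) :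
    ∀ᵐ x ∂(volume.restrict (Ioo (0 : ℝ) 1)),
      prim c h x = (u0 x + ∫ y in (0 : ℝ)..x, u1 y) / 2 ∧
      prim c h (-x) = (u0 x - ∫ y in (0 : ℝ)..x, u1 y) / 2 := by
  filter_upwards [h0, ae_restrict_mem measurableSet_Ioo] with x hx hxm
  have e : ∫ y in (0 : ℝ)..x, u1 y = ∫ y in (0 : ℝ)..x, (h y + h (-y)) := by
    refine intervalIntegral.integral_congr_ae ?_
    rw [ae_restrict_iff' measurableSet_Ioo] at h1
    filter_upwards [h1] with y hy hym
    rw [uIoc_of_le hxm.1.le] at hym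
    exact hy ⟨hym.1, hym.2.trans_lt hxm.2⟩
  rw [e, ← prim_sub_prim_neg c hh, hx]
  constructor <;> ring

variable {k : ℝ}

/-- The functional equation propagates zeros from `(-1, 1)` to `(-1, ∞)`. -/
theorem ae_eq_zero_of_functional_eq (hk : 0 < k) (hk1 : k < 1) {a : ℝ} {h : ℝ → ℝ}
    (hF : ∀ᵐ s ∂(volume.restrict (Ioi (-1 : ℝ))), (1 + a) * h (F k s) = (1 - a) * h s)
    (h0 : ∀ᵐ s ∂(volume.restrict (Ioo (-1 : ℝ) 1)), h s = 0) :
    ∀ᵐ s ∂(volume.restrict (Ioi (-1 : ℝ))), h s = 0 := by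
  by_cases ha : 1 + a = 0
  · filter_upwards [hF] with s hs
    have : a = -1 := by linarith
    subst this
    norm_num at hs
    exact hs
  have hn : 0 < 1 - k := by linarith
  have hp : 0 < 1 + k := by linarith
  rw [ae_restrict_iff' measurableSet_Ioi] at hF
  rw [ae_restrict_iff' measurableSet_Ioo] at h0
  -- Induction on the number of inverse iterates needed to come below `1`; the inductive step
  -- divides by `1 + a`. The point `s = 1`, whose preimage is the excluded endpoint `-1`, is
  -- discarded as a null set.
  have step : ∀ n : ℕ, ∀ᵐ s : ℝ, -1 < s → backIter k n s < 1 → h s = 0 := by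
    intro n
    induction n with
    | zero =>
      filter_upwards [h0] with s hs h1 h2
      exact hs ⟨h1, by rwa [backIter_zero] at h2⟩
    | succ n ih =>
      have hm : (1 - k) / (1 + k) ≠ 0 := (div_pos hn hp).ne'
      have qm := quasiMeasurePreserving_affine (-2 / (1 + k)) hm
      have hne : ∀ᵐ s : ℝ, s ≠ 1 := by simp [ae_iff]
      filter_upwards [qm.ae hF, qm.ae ih, h0, hne] with s h1 h2 h3 h4 h5 h6
      rcases lt_or_gt_of_ne h4 with h7 | h7
      · exact h3 ⟨h5, h7⟩
      set y := -2 / (1 + k) + (1 - k) / (1 + k) * s with hy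
      have hFy : F k y = s := by rw [F, hy]; field_simp; ring
      have hy1 : -1 < y := by
        have : y = (-2 + (1 - k) * s) / (1 + k) := by rw [hy]; ring
        rw [this, lt_div_iff₀ hp]
        nlinarith
      have h8 := h2 hy1 (by rwa [← backIter_succ_F hk hk1, hFy])
      have h9 := h1 hy1
      rw [hFy, h8, mul_zero] at h9
      exact (mul_eq_zero.1 h9).resolve_left ha
  rw [ae_restrict_iff' measurableSet_Ioi]
  filter_upwards [ae_all_iff.2 step] with s hs hs1
  obtain ⟨N, hN⟩ := exists_backIter_le hk hk1 s
  exact hs N hs1 (by linarith [hN N le_rfl s le_rfl])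

/-- The difference of the two profiles vanishes on `(-1, 1)` since both are given there by the data.
Its derivative then vanishes on `(-1, ∞)` by the functional equation, and on `Q k` both arguments `t
± x` exceed `-1`. -/
theorem ae_eq_of_isWeakSolution (hk : 0 < k) (hk1 : k < 1) {a : ℝ} {u0 u1 : ℝ → ℝ}
    (hu0 : MemL2loc (Ioo 0 1) u0) (hu1 : MemLp u1 2 (volume.restrict (Ioo (0 : ℝ) 1)))
    {u v : ℝ × ℝ → ℝ} (hu : IsWeakSolution k a u0 u1 u) (hv : IsWeakSolution k a u0 u1 v) :
    ∀ᵐ z ∂(volume.restrict (Q k)), u z = v z := by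
  obtain ⟨c₁, h₁, hh₁, hu₁, h0₁, h1₁, hF₁⟩ := hu.exists_profile hk hk1 hu0 hu1
  obtain ⟨c₂, h₂, hh₂, hu₂, h0₂, h1₂, hF₂⟩ := hv.exists_profile hk hk1 hu0 hu1
  have hD := hh₁.sub hh₂
  have hP (s : ℝ) : prim (c₁ - c₂) (fun s => h₁ s - h₂ s) s = prim c₁ h₁ s - prim c₂ h₂ s := by
    rw [prim, prim, prim, intervalIntegral.integral_sub (hh₁.intervalIntegrable _ _)
      (hh₂.intervalIntegrable _ _)]
    ring
  set D : ℝ → ℝ := fun s => h₁ s - h₂ s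
  set P := prim (c₁ - c₂) D with hPdef
  have hPc : Continuous P := continuous_prim _ hD
  have hPx : ∀ᵐ x ∂(volume.restrict (Ioo (0 : ℝ) 1)), P x = 0 ∧ P (-x) = 0 := by
    filter_upwards [eq_half_data hh₁ h0₁ h1₁, eq_half_data hh₂ h0₂ h1₂] with x h1 h2
    rw [hP, hP, h1.1, h1.2, h2.1, h2.2, sub_self, sub_self]
    exact ⟨rfl, rfl⟩
  have hPpos : ∀ᵐ x ∂(volume.restrict (Ioo (0 : ℝ) 1)), P x = 0 := hPx.mono fun x hx => hx.1
  have hPneg : ∀ᵐ x ∂(volume.restrict (Ioo (-1 : ℝ) 0)), P x = 0 := by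
    have := ae_comp_neg_Ioo (hPx.mono fun x hx => hx.2)
    simpa using this
  have hP0 : ∀ᵐ x ∂(volume.restrict (Ioo (-1 : ℝ) 1)), P x = 0 := by
    rw [ae_restrict_iff' measurableSet_Ioo] at hPpos hPneg ⊢
    have hne : ∀ᵐ s : ℝ, s ≠ 0 := by simp [ae_iff]
    filter_upwards [hPpos, hPneg, hne] with x h1 h2 h3 hx
    rcases lt_or_gt_of_ne h3 with h | h
    · exact h2 ⟨hx.1, h⟩
    · exact h1 ⟨h, hx.2⟩
  -- Continuity upgrades vanishing almost everywhere to vanishing at `0`, which fixes the constant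
  -- of integration.
  have hc : P 0 = 0 := by
    have := Measure.eqOn_of_ae_eq (μ := volume) (g := fun _ => (0 : ℝ)) hP0 hPc.continuousOn
      continuousOn_const (by rw [interior_Ioo]; exact subset_closure)
    exact this (by simp : (0 : ℝ) ∈ Ioo (-1) 1)
  have hD0 : ∀ᵐ x ∂(volume.restrict (Ioo (-1 : ℝ) 1)), D x = 0 :=
    HasWeakDeriv.ae_unique isOpen_Ioo (u := P) (v := fun _ => 0) (hD.mono (subset_univ _))
      (memL2loc_of_continuous continuous_const) hP0 (hasWeakDeriv_prim _ hD _)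
      fun φ _ _ => by simp
  have hDF : ∀ᵐ s ∂(volume.restrict (Ioi (-1 : ℝ))), (1 + a) * D (F k s) = (1 - a) * D s := by
    filter_upwards [hF₁, hF₂] with s h1 h2
    simp only [D]
    linear_combination h1 - h2
  have hDz := ae_eq_zero_of_functional_eq hk hk1 hDF hD0
  have hPz {s : ℝ} (hs : -1 < s) : prim c₁ h₁ s = prim c₂ h₂ s := by
    rw [← sub_eq_zero, ← hP, ← hc, hPdef, prim_eq_of_ae_eq_zero hDz hs,
      prim_eq_of_ae_eq_zero hDz (by norm_num)]
  filter_upwards [hu₁, hu₂, ae_restrict_mem (measurableSet_Q k)] with z h1 h2 hz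
  obtain ⟨q1, q2, q3⟩ := hz
  rw [h1, h2, wave, wave, hPz (by linarith), hPz (by nlinarith)]

theorem trivial_of_isWeakSolution (hk : 0 < k) (hk1 : k < 1) {u0 u1 : ℝ → ℝ}
    (hu0 : MemL2loc (Ioo 0 1) u0) (hu1 : MemLp u1 2 (volume.restrict (Ioo (0 : ℝ) 1)))
    {u : ℝ × ℝ → ℝ} (hu : IsWeakSolution k (-1) u0 u1 u) :
    (∃ c : ℝ, ∀ᵐ x ∂(volume.restrict (Ioo (0 : ℝ) 1)), u0 x = c) ∧
      ∀ᵐ x ∂(volume.restrict (Ioo (0 : ℝ) 1)), u1 x = 0 := by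
  obtain ⟨c, h, hh, -, h0, h1, hF⟩ := hu.exists_profile hk hk1 hu0 hu1
  -- For `a = -1` the functional equation reads `0 = 2 h(s)`.
  have hz : ∀ᵐ s ∂(volume.restrict (Ioi (-1 : ℝ))), h s = 0 := by
    filter_upwards [hF] with s hs
    norm_num at hs
    exact hs
  constructor
  · refine ⟨c + c, ?_⟩
    filter_upwards [h0, ae_restrict_mem measurableSet_Ioo] with x hx hxm
    rw [hx, prim_eq_of_ae_eq_zero hz (by linarith [hxm.1]),
      prim_eq_of_ae_eq_zero hz (by linarith [hxm.2])]
  · have hz1 := ae_restrict_of_ae_restrict_of_subset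
      (show Ioo (0 : ℝ) 1 ⊆ Ioi (-1) from fun x hx => lt_trans (by norm_num) hx.1) hz
    have hz2 := ae_comp_neg_Ioo (ae_restrict_of_ae_restrict_of_subset
      (show Ioo (-1 : ℝ) 0 ⊆ Ioi (-1) from Ioo_subset_Ioi_self) hz)
    rw [neg_zero, neg_neg] at hz2
    filter_upwards [h1, hz1, hz2] with x e1 e2 e3
    rw [e1, e2, e3, add_zero]

end Uniqueness

end

end MovingWave

theorem theorem2p1 (k : ℝ) (hk0 : 0 < k) (hk1 : k < 1) (a : ℝ) (u0 u1 : ℝ → ℝ)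
    (hu0 : MovingWave.MemH1 (Ioo 0 1) u0)
    (hu1 : MemLp u1 2 (volume.restrict (Ioo (0 : ℝ) 1))) :
    -- existence
    (a ≠ -1 → ∃ u : ℝ × ℝ → ℝ, MovingWave.IsWeakSolution k a u0 u1 u) ∧
    -- existence in the degenerate case: exactly for trivial data
    (a = -1 → ((∃ u : ℝ × ℝ → ℝ, MovingWave.IsWeakSolution k a u0 u1 u) ↔
      (∃ c : ℝ, ∀ᵐ x ∂(volume.restrict (Ioo (0 : ℝ) 1)), u0 x = c) ∧
        ∀ᵐ x ∂(volume.restrict (Ioo (0 : ℝ) 1)), u1 x = 0)) ∧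
    -- uniqueness, for every `a`
    (∀ u v : ℝ × ℝ → ℝ, MovingWave.IsWeakSolution k a u0 u1 u →
      MovingWave.IsWeakSolution k a u0 u1 v →
      ∀ᵐ z ∂(volume.restrict (MovingWave.Q k)), u z = v z) ∧
    -- the form of the solution, for every `a`
    (∀ u : ℝ × ℝ → ℝ, MovingWave.IsWeakSolution k a u0 u1 u →
      ∃ f f' : ℝ → ℝ, MovingWave.IsH1loc univ f f' ∧
        (∀ᵐ z ∂(volume.restrict (MovingWave.Q k)), u z = f (z.2 + z.1) + f (z.2 - z.1)) ∧
        (∀ᵐ x ∂(volume.restrict (Ioo (0 : ℝ) 1)),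
          f x = (u0 x + ∫ y in (0 : ℝ)..x, u1 y) / 2 ∧
          f (-x) = (u0 x - ∫ y in (0 : ℝ)..x, u1 y) / 2) ∧
        (∀ᵐ s ∂(volume.restrict (Ioi (-1 : ℝ))),
          (1 + a) * f' (MovingWave.F k s) = (1 - a) * f' s)) := by
  have hu0' := MovingWave.memL2loc_of_memLp hu0.1
  refine ⟨fun ha => MovingWave.exists_isWeakSolution hk0 hk1 ha hu0 hu1, fun ha => ?_,
    fun u v hu hv => MovingWave.ae_eq_of_isWeakSolution hk0 hk1 hu0' hu1 hu hv, fun u hu => ?_⟩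
  · subst ha
    exact ⟨fun ⟨u, hu⟩ => MovingWave.trivial_of_isWeakSolution hk0 hk1 hu0' hu1 hu,
      fun ⟨h0, h1⟩ => MovingWave.exists_isWeakSolution_of_trivial hk0 hk1 (-1) h0 h1⟩
  · obtain ⟨c, h, hh, hw, h0, h1, hF⟩ := hu.exists_profile hk0 hk1 hu0' hu1
    exact ⟨MovingWave.prim c h, h, MovingWave.isH1loc_prim c hh univ, hw,
      MovingWave.eq_half_data hh h0 h1, hF⟩
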